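/- Let $D\ge 1$ and $\ell\ge 2$ be integers and let $\mathcal F_n$ be the family of $\ell$-adic cubes $\prod_{i=1}^D[k_i\ell^{-n},(k_i+1)\ell^{-n})$, $0\le k_i<\ell^n$, of $[0,1)^D$. Suppose that the cubes of $\mathcal F_n$ are coded bijectively as $I_{\varepsilon_1\cdots\varepsilon_n}$, $0\le\varepsilon_i<\ell^D$, for every $n\ge 0$, in such a way that $I_{\varepsilon_1\cdots\varepsilon_{n+1}}\subset I_{\varepsilon_1\cdots\varepsilon_n}$, and for $I=I_{\varepsilon_1\cdots\varepsilon_n}$, $J=I_{\varepsilon_{n+1}\cdots\varepsilon_{n+p}}$ write $IJ=I_{\varepsilon_1\cdots\varepsilon_{n+p}}$. Let $m$ be a quasi-Bernoulli measure, that is, a Borel probability measure on $[0,1)^D$ for which there is a constant $C\ge 1$ with $$\frac1C\,m(I)m(J)\le m(IJ)\le C\,m(I)m(J)\qquad\text{for all } I,J\in\bigcup_n\mathcal F_n .$$ Let $$\tau(q)=\limsup_{n\to\infty}\frac1{n\log\ell}\log\Big(\sum_{I\in\mathcal F_n,\ m(I)>0}m(I)^q\Big),\qquad d=-\tau'(1),\qquad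 \chi(q)=\tau(1-q)-qd,$$ and let $S_n(x)=-\sum_{k=1}^n\log_\ell\frac{m(I_k(x))}{m(I_{k-1}(x))}$, where $I_k(x)$ is the cube of $\mathcal F_k$ containing $x$. Suppose that there is a constant $C>0$ such that $$\forall q\in(0,1],\qquad 0<\chi(q)\le C\,\chi(q/2).$$ Then $\chi$ is a bijection of $[0,1]$ onto $[0,\chi(1)]$; write $\chi^{-1}$ for its inverse and $\theta(t)=1/\chi^{-1}(1/t)$ for $t\ge 1/\chi(1)$. For $m$-almost every $x$, $$\limsup_{n\to\infty}\frac{S_n(x)-nd}{\theta(n)}\ge 1 .$$ As a consequence, for every $0<a<1$, $$m\ll\widehat{\mathcal P}^{\psi_a},\qquad \psi_a(t)=t^d\,\ell^{-a\,\theta(\log_\ell(1/t))}\quad(t>0\text{ small}),$$ and in particular $m\ll\widehat{\mathcal P}^d$, the packing measure for the gauge $t^d$. Here, for a gauge $\psi$, $\widehat{\mathcal P}^\psi(E)=\inf\{\sum_i\mathcal P^\psi(E_i): E\subset\bigcup_{i\in\mathbb N}E_i\}$ is the packing measure on $\mathbb R^D$, where $\mathcal P^\psi(E)=\lim_{\delta\to0}\sup\sum_i\psi(2r_i)$,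 the supremum being over countable families of pairwise disjoint closed Euclidean balls with centres in $E$ and radii $0<r_i\le\delta$. -/

import Mathlib

open MeasureTheory Filter Set
open scoped ENNReal

noncomputable section

namespace QuasiBernoulli

/-! ### Packing measures -/

section Packing

variable {X : Type*} [MetricSpace X]

/-- A `δ`-packing of `E`: a countable family of pairwise disjoint closed balls, coded by
(centre, radius), with centres in `E` and radii in `(0, δ]`. -/
structure IsPacking (δ : ℝ) (E : Set X) (S : Set (X × ℝ)) : Prop where
  countable : S.Countable
  center_mem : ∀ p ∈ S, p.1 ∈ E
  radius_pos : ∀ p ∈ S, 0 < p.2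
  radius_le : ∀ p ∈ S, p.2 ≤ δ
  disjoint : S.PairwiseDisjoint fun p => Metric.closedBall p.1 p.2

/-- `P^ψ_δ(E) = sup ∑ ψ(2 rᵢ)` over all `δ`-packings of `E`; in `ℝ^D`, `D ≥ 1`, the number `2 rᵢ`
is the diameter of the ball. -/
def packingPreAt (ψ : ℝ → ℝ≥0∞) (δ : ℝ) (E : Set X) : ℝ≥0∞ :=
  ⨆ (S : Set (X × ℝ)) (_ : IsPacking δ E S), ∑' p : S, ψ (2 * (p : X × ℝ).2)

/-- The packing pre-measure `P^ψ(E) = lim_{δ → 0} P^ψ_δ(E)` (an infimum, by monotonicity). -/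
def packingPre (ψ : ℝ → ℝ≥0∞) (E : Set X) : ℝ≥0∞ :=
  ⨅ (δ : ℝ) (_ : 0 < δ), packingPreAt ψ δ E

theorem IsPacking.mono {δ δ' : ℝ} {E F : Set X} {S : Set (X × ℝ)} (h : IsPacking δ E S)
    (hδ : δ ≤ δ') (hE : E ⊆ F) : IsPacking δ' F S :=
  ⟨h.countable, fun p hp => hE (h.center_mem p hp), h.radius_pos,
    fun p hp => (h.radius_le p hp).trans hδ, h.disjoint⟩

theorem packingPreAt_mono (ψ : ℝ → ℝ≥0∞) {δ δ' : ℝ} {E F : Set X} (hδ : δ ≤ δ') (hE : E ⊆ F) :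
    packingPreAt ψ δ E ≤ packingPreAt ψ δ' F :=
  iSup₂_le fun S hS => le_iSup₂_of_le S (hS.mono hδ hE) le_rfl

theorem packingPre_mono (ψ : ℝ → ℝ≥0∞) {E F : Set X} (hE : E ⊆ F) :
    packingPre ψ E ≤ packingPre ψ F :=
  iInf₂_mono fun _ _ => packingPreAt_mono ψ le_rfl hE

theorem packingPre_empty (ψ : ℝ → ℝ≥0∞) : packingPre ψ (∅ : Set X) = 0 := by
  refine le_antisymm (iInf₂_le_of_le 1 one_pos (iSup₂_le fun S hS => ?_)) (zero_le)
  have : S = ∅ := eq_empty_of_forall_notMem fun p hp => hS.center_mem p hp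
  subst this
  simp

/-- The packing outer measure `P̂^ψ(E) = inf {∑ P^ψ(Eᵢ) : E ⊆ ⋃ Eᵢ}` (countable covers). -/
def packingOuter (ψ : ℝ → ℝ≥0∞) : OuterMeasure X :=
  OuterMeasure.ofFunction (packingPre ψ) (packingPre_empty ψ)

theorem packingPre_add_le (ψ : ℝ → ℝ≥0∞) {s t : Set X} (h : Metric.AreSeparated s t) :
    packingPre ψ s + packingPre ψ t ≤ packingPre ψ (s ∪ t) := by
  obtain ⟨r, hr0, hr⟩ := h
  obtain ⟨η, hη, hηr⟩ : ∃ η : ℝ, 0 < η ∧ ENNReal.ofReal (η + η) < r := by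
    obtain ⟨c, hc0, hcr⟩ := exists_between (pos_iff_ne_zero.2 hr0)
    have hct : c ≠ ∞ := hcr.ne_top
    have := ENNReal.toReal_pos hc0.ne' hct
    refine ⟨c.toReal / 2, by positivity, ?_⟩
    rwa [add_halves, ENNReal.ofReal_toReal hct]
  refine le_iInf₂ fun δ hδ => ?_
  have key : packingPreAt ψ (min δ η) s + packingPreAt ψ (min δ η) t
      ≤ packingPreAt ψ δ (s ∪ t) := by
    refine ENNReal.biSup_add_biSup_le' (p := IsPacking (min δ η) s)
      (q := IsPacking (min δ η) t) ⟨∅, by constructor <;> simp⟩ ⟨∅, by constructor <;> simp⟩ ?_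
    intro S hS T hT
    have hfar : ∀ p ∈ S, ∀ q ∈ T,
        Disjoint (Metric.closedBall p.1 p.2) (Metric.closedBall q.1 q.2) := by
      intro p hp q hq
      refine Metric.closedBall_disjoint_closedBall ?_
      by_contra! hle
      have h1 := hr p.1 (hS.center_mem p hp) q.1 (hT.center_mem q hq)
      rw [edist_dist] at h1
      have h2 : dist p.1 q.1 ≤ η + η :=
        hle.trans (add_le_add ((hS.radius_le p hp).trans (min_le_right _ _))
          ((hT.radius_le q hq).trans (min_le_right _ _)))
      exact absurd (h1.trans (ENNReal.ofReal_le_ofReal h2)) (not_le.2 hηr)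
    have hST : Disjoint S T := by
      refine Set.disjoint_left.2 fun p hp hq => ?_
      have := hfar p hp p hq
      rw [disjoint_self] at this
      have hmem := Metric.mem_closedBall_self (x := p.1) (hS.radius_pos p hp).le
      rw [this] at hmem
      exact hmem
    have hU : IsPacking δ (s ∪ t) (S ∪ T) := by
      refine ⟨hS.countable.union hT.countable, ?_, ?_, ?_, ?_⟩
      · rintro p (hp | hp)
        · exact Or.inl (hS.center_mem p hp)
        · exact Or.inr (hT.center_mem p hp)
      · rintro p (hp | hp)
        · exact hS.radius_pos p hp
        · exact hT.radius_pos p hp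
      · rintro p (hp | hp)
        · exact (hS.radius_le p hp).trans (min_le_left _ _)
        · exact (hT.radius_le p hp).trans (min_le_left _ _)
      · rintro p (hp | hp) q (hq | hq) hne
        · exact hS.disjoint hp hq hne
        · exact hfar p hp q hq
        · exact (hfar q hq p hp).symm
        · exact hT.disjoint hp hq hne
    refine le_iSup₂_of_le (S ∪ T) hU (le_of_eq ?_)
    exact (ENNReal.summable.tsum_union_disjoint (f := fun p : X × ℝ => ψ (2 * p.2)) hST
      ENNReal.summable).symm
  have hm : 0 < min δ η := lt_min hδ hη
  exact (add_le_add (iInf₂_le _ hm) (iInf₂_le _ hm)).trans key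

theorem packingOuter_isMetric (ψ : ℝ → ℝ≥0∞) : (packingOuter ψ : OuterMeasure X).IsMetric := by
  intro s t hst
  refine le_antisymm (measure_union_le s t) ?_
  conv_rhs => rw [packingOuter, OuterMeasure.ofFunction_apply]
  refine le_iInf₂ fun U hU => ?_
  have hs : packingOuter ψ s ≤ ∑' i, packingPre ψ (U i ∩ s) := by
    rw [packingOuter, OuterMeasure.ofFunction_apply]
    refine iInf₂_le (fun i => U i ∩ s) fun x hx => ?_
    obtain ⟨i, hi⟩ := mem_iUnion.1 (hU (Or.inl hx))
    exact mem_iUnion.2 ⟨i, hi, hx⟩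
  have ht : packingOuter ψ t ≤ ∑' i, packingPre ψ (U i ∩ t) := by
    rw [packingOuter, OuterMeasure.ofFunction_apply]
    refine iInf₂_le (fun i => U i ∩ t) fun x hx => ?_
    obtain ⟨i, hi⟩ := mem_iUnion.1 (hU (Or.inr hx))
    exact mem_iUnion.2 ⟨i, hi, hx⟩
  refine (add_le_add hs ht).trans ?_
  rw [← ENNReal.tsum_add]
  refine ENNReal.tsum_le_tsum fun i => ?_
  have hsep : Metric.AreSeparated (U i ∩ s) (U i ∩ t) :=
    hst.mono inter_subset_right inter_subset_right
  exact (packingPre_add_le ψ hsep).trans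
    (packingPre_mono ψ (union_subset inter_subset_left inter_subset_left))

/-- The packing measure `P̂^ψ`, as a Borel measure. -/
def packingMeasure [MeasurableSpace X] [BorelSpace X] (ψ : ℝ → ℝ≥0∞) : Measure X :=
  (packingOuter ψ).toMeasure <| by
    rw [BorelSpace.measurable_eq (α := X)]
    exact (packingOuter_isMetric ψ).borel_le_caratheodory

end Packing

/-! ### `ℓ`-adic cubes, quasi-Bernoulli measures, the `L^q`-spectrum -/

/-- The unit cube `[0,1)^D`. -/
def unitCube (D : ℕ) : Set (EuclideanSpace ℝ (Fin D)) := {x | ∀ i, x i ∈ Ico (0 : ℝ) 1}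

/-- The cube `∏ [k_i / ℓ^n, (k_i + 1) / ℓ^n)`. -/
def adicCube (ℓ D n : ℕ) (k : Fin D → ℕ) : Set (EuclideanSpace ℝ (Fin D)) :=
  {x | ∀ i, x i ∈ Ico ((k i : ℝ) / (ℓ : ℝ) ^ n) (((k i : ℝ) + 1) / (ℓ : ℝ) ^ n)}

/-- The family `𝓕_n` of `ℓ`-adic cubes of generation `n` in `[0,1)^D`. -/
def adicCubes (ℓ D n : ℕ) : Set (Set (EuclideanSpace ℝ (Fin D))) :=
  {Q | ∃ k : Fin D → ℕ, (∀ i, k i < ℓ ^ n) ∧ Q = adicCube ℓ D n k}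

/-- `I_n(x)`: for `x ∈ [0,1)^D`, the unique cube of `𝓕_n` that contains `x`. -/
def cubeAt (ℓ D n : ℕ) (x : EuclideanSpace ℝ (Fin D)) : Set (EuclideanSpace ℝ (Fin D)) :=
  adicCube ℓ D n fun i => ⌊(ℓ : ℝ) ^ n * x i⌋₊

/-- A coding `ε₁ ⋯ ε_n ↦ I_{ε₁ ⋯ ε_n}` of the `ℓ`-adic cubes by words over an alphabet with `ℓ^D`
letters: words of length `n` code the cubes of `𝓕_n` bijectively, compatibly with inclusion. -/
structure IsAdicCoding (ℓ D : ℕ)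
    (I : List (Fin (ℓ ^ D)) → Set (EuclideanSpace ℝ (Fin D))) : Prop where
  bijOn : ∀ n, BijOn I {w | w.length = n} (adicCubes ℓ D n)
  nested : ∀ w ε, I (w ++ [ε]) ⊆ I w

/-- The quasi-Bernoulli property `C⁻¹ m(I) m(J) ≤ m(IJ) ≤ C m(I) m(J)` for the coding `I`. -/
def IsQuasiBernoulli {ℓ D : ℕ} (I : List (Fin (ℓ ^ D)) → Set (EuclideanSpace ℝ (Fin D)))
    (m : Measure (EuclideanSpace ℝ (Fin D))) : Prop :=
  ∃ C : ℝ, 1 ≤ C ∧ ∀ u v : List (Fin (ℓ ^ D)),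
    1 / C * (m.real (I u) * m.real (I v)) ≤ m.real (I (u ++ v)) ∧
      m.real (I (u ++ v)) ≤ C * (m.real (I u) * m.real (I v))

variable (ℓ : ℕ) {D : ℕ} (m : Measure (EuclideanSpace ℝ (Fin D)))

/-- `τ_n(q) = (n log ℓ)⁻¹ log ∑_{I ∈ 𝓕_n} m(I)^q`; as usual, the cubes with `m(I) = 0` do not
contribute (this matters only for `q ≤ 0`, and ensures that `τ(0)` is the dimension of the
support). -/
def tauN (n : ℕ) (q : ℝ) : ℝ :=
  1 / (n * Real.log ℓ) *
    Real.log (∑ᶠ Q ∈ {Q ∈ adicCubes ℓ D n | 0 < m.real Q}, m.real Q ^ q)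

/-- The `L^q`-spectrum `τ(q) = limsup τ_n(q)`. -/
def tau (q : ℝ) : ℝ := limsup (fun n : ℕ => tauN ℓ m n q) atTop

/-- `d = -τ'(1)`. -/
def dimension : ℝ := -deriv (tau ℓ m) 1

/-- `χ(q) = τ(1 - q) - q d`. -/
def chi (q : ℝ) : ℝ := tau ℓ m (1 - q) - q * dimension ℓ m

/-- The inverse of `χ : [0,1] → [0, χ(1)]`. -/
def chiInv (y : ℝ) : ℝ := Function.invFunOn (chi ℓ m) (Icc 0 1) y

/-- `θ(t) = 1 / χ⁻¹(1/t)`; meaningful for `t ≥ 1 / χ(1)`. -/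
def theta (t : ℝ) : ℝ := 1 / chiInv ℓ m (1 / t)

/-- `X_n(x) = -log_ℓ (m(I_n(x)) / m(I_{n-1}(x)))`, `n ≥ 1`. -/
def X (n : ℕ) (x : EuclideanSpace ℝ (Fin D)) : ℝ :=
  -Real.logb ℓ (m.real (cubeAt ℓ D n x) / m.real (cubeAt ℓ D (n - 1) x))

/-- `S_n = X_1 + ⋯ + X_n`. -/
def S (n : ℕ) (x : EuclideanSpace ℝ (Fin D)) : ℝ := ∑ k ∈ Finset.Icc 1 n, X ℓ m k x

/-- The gauge `ψ_a(t) = t^d ℓ^{-a θ(log_ℓ (1/t))}`. Packing measures only depend on the values of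
the gauge at small `t > 0`. -/
def psi (a t : ℝ) : ℝ :=
  t ^ dimension ℓ m * (ℓ : ℝ) ^ (-(a * theta ℓ m (Real.logb ℓ (1 / t))))

end QuasiBernoulli

end

/-!
The value `χ(q)` is the exponential growth rate of the moments of `S_n - n d` at `q`. At
`q = 2^j / θ(n)` these moments stay between constants depending on `j`, since `χ(1 / θ(n)) = 1 / n`
and `χ` is convex and doubling. Comparing the moments at `q` and `2 q` (Paley–Zygmund) for a fixed
large `j`, the event `S_n - n d ≥ a θ(n)` has probability bounded below, for each `a < 1`. By the
quasi-Bernoulli property the bound persists inside every cube, so a conditional Borel–Cantelli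
argument yields the event infinitely often, almost surely.

For packing measures the cubes are replaced by balls: almost surely, the mass of the ball of radius
`ℓ^{-n}` around `x` is eventually at most `(n + 1)²` times that of the cube, by Markov's inequality
and Borel–Cantelli. Doubling forces `θ` to grow at least like a power, so this polynomial factor is
absorbed by a slight change of `a`, and a Vitali covering compares `m` with the packing measure.
-/

noncomputable section

open scoped Topology

namespace QuasiBernoulli

/-! ### Almost additive sequences -/

section AlmostAdditive

variable {a : ℕ → ℝ} {K : ℝ}

theorem abs_mul_sub_le_of_almost_additive (h : ∀ n p, |a (n + p) - (a n + a p)| ≤ K) (n p : ℕ) :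
    |a (n * (p + 1)) - (p + 1) * a n| ≤ p * K := by
  induction p with
  | zero => simp
  | succ p ih =>
    calc |a (n * (p + 1 + 1)) - ((p + 1 : ℕ) + 1) * a n|
        = |(a (n * (p + 1) + n) - (a (n * (p + 1)) + a n))
            + (a (n * (p + 1)) - (p + 1) * a n)| := by
          rw [mul_add_one n (p + 1)]
          push_cast
          ring_nf
      _ ≤ K + p * K := (abs_add_le _ _).trans (add_le_add (h _ _) ih)
      _ = (p + 1 : ℕ) * K := by push_cast; ring

theorem exists_linear_approx_of_almost_additive (h : ∀ n p, |a (n + p) - (a n + a p)| ≤ K) :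
    ∃ L : ℝ, ∀ n : ℕ, |a n - n * L| ≤ K := by
  have lower_le_upper : ∀ n p : ℕ,
      (a (n + 1) - K) / (n + 1) ≤ (a (p + 1) + K) / (p + 1) := fun n p => by
    have hn := abs_le.1 (abs_mul_sub_le_of_almost_additive h (n + 1) p)
    have hp := abs_le.1 (abs_mul_sub_le_of_almost_additive h (p + 1) n)
    have hK : 0 ≤ K := (abs_nonneg _).trans (h 0 0)
    rw [mul_comm (p + 1)] at hp
    rw [div_le_div_iff₀ (by positivity) (by positivity)]
    linarith [hn.1, hp.2]
  obtain ⟨L, hlower, hupper⟩ := exists_between_of_forall_le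
    (range_nonempty fun n : ℕ => (a (n + 1) - K) / (n + 1))
    (range_nonempty fun n : ℕ => (a (n + 1) + K) / (n + 1))
    (by rintro _ ⟨n, rfl⟩ _ ⟨p, rfl⟩; exact lower_le_upper n p)
  refine ⟨L, fun n => ?_⟩
  rcases n with _ | n
  · simpa using h 0 0
  · have hl := (div_le_iff₀ (by positivity)).1 (hlower (mem_range_self n))
    have hu := (le_div_iff₀ (by positivity)).1 (hupper (mem_range_self n))
    rw [abs_le]
    push_cast
    constructor <;> linarith

theorem tendsto_div_of_linear_approx {L : ℝ} (h : ∀ n : ℕ, |a n - n * L| ≤ K) :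
    Tendsto (fun n : ℕ => a n / n) atTop (𝓝 L) := by
  rw [tendsto_iff_norm_sub_tendsto_zero]
  refine squeeze_zero' (.of_forall fun _ => norm_nonneg _) ?_
    (tendsto_const_div_atTop_nhds_zero_nat K)
  filter_upwards [eventually_gt_atTop 0] with n hn
  have hn' : (0 : ℝ) < n := by exact_mod_cast hn
  rw [Real.norm_eq_abs, le_div_iff₀ hn', ← abs_of_pos hn', ← abs_mul, abs_of_pos hn', sub_mul,
    div_mul_cancel₀ _ hn'.ne', mul_comm L]
  exact h n

end AlmostAdditive

/-! ### Powers and power sums -/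

section PowerSums

variable {x y C : ℝ}

theorem rpow_le_rpow_abs_mul_rpow (hx : 0 < x) (hy : 0 < y) (hC : 0 ≤ C) (hxy : x ≤ C * y)
    (hyx : y ≤ C * x) (q : ℝ) : x ^ q ≤ C ^ |q| * y ^ q := by
  rcases le_total 0 q with hq | hq
  · rw [abs_of_nonneg hq, ← Real.mul_rpow hC hy.le]
    exact Real.rpow_le_rpow hx.le hxy hq
  · have hCpos : 0 < C := pos_of_mul_pos_left (hx.trans_le hxy) hy.le
    rw [abs_of_nonpos hq, Real.rpow_neg hC, le_inv_mul_iff₀ (Real.rpow_pos_of_pos hCpos _),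
      ← Real.mul_rpow hC hx.le]
    exact Real.rpow_le_rpow_of_nonpos hy hyx hq

theorem abs_log_sub_log_le (hx : 0 < x) (hy : 0 < y) (hC : 0 < C) (hxy : x ≤ C * y)
    (hyx : y ≤ C * x) : |Real.log x - Real.log y| ≤ Real.log C := by
  have h₁ := Real.log_le_log hx hxy
  have h₂ := Real.log_le_log hy hyx
  rw [Real.log_mul hC.ne' hy.ne'] at h₁
  rw [Real.log_mul hC.ne' hx.ne'] at h₂
  exact abs_le.2 ⟨by linarith, by linarith⟩

theorem le_mul_of_abs_log_sub_log_le (hx : 0 < x) (hy : 0 < y) (hC : 0 < C)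
    (h : |Real.log x - Real.log y| ≤ Real.log C) : x ≤ C * y := by
  rw [← Real.log_le_log_iff hx (mul_pos hC hy), Real.log_mul hC.ne' hy.ne']
  exact sub_le_iff_le_add.1 (abs_le.1 h).2

variable {ι : Type*} {s : Finset ι} {p f : ι → ℝ}

theorem sum_rpow_pos (hp : ∀ i ∈ s, 0 < p i) (hs : s.Nonempty) (t : ℝ) : 0 < ∑ i ∈ s, p i ^ t :=
  Finset.sum_pos (fun i hi => Real.rpow_pos_of_pos (hp i hi) t) hs

theorem sum_rpow_add_le (hp : ∀ i ∈ s, 0 < p i) (hs : s.Nonempty) {a b : ℝ} (ha : 0 ≤ a)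
    (hb : 0 ≤ b) (hab : a + b = 1) (u v : ℝ) :
    ∑ i ∈ s, p i ^ (a * u + b * v) ≤ (∑ i ∈ s, p i ^ u) ^ a * (∑ i ∈ s, p i ^ v) ^ b := by
  set U := ∑ i ∈ s, p i ^ u
  set V := ∑ i ∈ s, p i ^ v
  have hUpos : 0 < U := sum_rpow_pos hp hs u
  have hVpos : 0 < V := sum_rpow_pos hp hs v
  have weighted_am_gm : ∀ i ∈ s, p i ^ (a * u + b * v)
      ≤ U ^ a * V ^ b * (a * (p i ^ u / U) + b * (p i ^ v / V)) := fun i hi => by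
    have hi0 := hp i hi
    have hiu := (Real.rpow_pos_of_pos hi0 u).le
    have hiv := (Real.rpow_pos_of_pos hi0 v).le
    have := Real.geom_mean_le_arith_mean2_weighted ha hb (div_nonneg hiu hUpos.le)
      (div_nonneg hiv hVpos.le) hab
    rwa [Real.div_rpow hiu hUpos.le, Real.div_rpow hiv hVpos.le, div_mul_div_comm,
      div_le_iff₀' (by positivity), ← Real.rpow_mul hi0.le, ← Real.rpow_mul hi0.le,
      ← Real.rpow_add hi0, mul_comm u, mul_comm v] at this
  calc ∑ i ∈ s, p i ^ (a * u + b * v)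
      ≤ ∑ i ∈ s, U ^ a * V ^ b * (a * (p i ^ u / U) + b * (p i ^ v / V)) :=
        Finset.sum_le_sum weighted_am_gm
    _ = U ^ a * V ^ b * (a * (U / U) + b * (V / V)) := by
        rw [← Finset.mul_sum, Finset.sum_add_distrib, ← Finset.mul_sum, ← Finset.mul_sum,
          ← Finset.sum_div, ← Finset.sum_div]
    _ = U ^ a * V ^ b := by
        rw [div_self hUpos.ne', div_self hVpos.ne', mul_one, mul_one, hab, mul_one]

theorem convexOn_log_sum_rpow (hp : ∀ i ∈ s, 0 < p i) (hs : s.Nonempty) :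
    ConvexOn ℝ univ fun t : ℝ => Real.log (∑ i ∈ s, p i ^ t) := by
  refine ⟨convex_univ, fun u _ v _ a b ha hb hab => ?_⟩
  have hsu := sum_rpow_pos hp hs u
  have hsv := sum_rpow_pos hp hs v
  have hu := Real.rpow_pos_of_pos hsu a
  have hv := Real.rpow_pos_of_pos hsv b
  simp only [smul_eq_mul]
  rw [← Real.log_rpow hsu, ← Real.log_rpow hsv, ← Real.log_mul hu.ne' hv.ne']
  exact Real.log_le_log (sum_rpow_pos hp hs _) (sum_rpow_add_le hp hs ha hb hab u v)

theorem paley_zygmund_sum (hp : ∀ i ∈ s, 0 ≤ p i) (hsum : ∑ i ∈ s, p i ≤ 1) {t : ℝ} (ht : 0 ≤ t)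
    (hle : t ≤ ∑ i ∈ s, p i * f i) :
    (∑ i ∈ s, p i * f i - t) ^ 2 ≤ (∑ i ∈ s with t < f i, p i) * ∑ i ∈ s, p i * f i ^ 2 := by
  have small_part : ∑ i ∈ s with ¬ t < f i, p i * f i ≤ t := calc
    _ ≤ ∑ i ∈ s with ¬ t < f i, p i * t := by
        refine Finset.sum_le_sum fun i hi => ?_
        rw [Finset.mem_filter, not_lt] at hi
        exact mul_le_mul_of_nonneg_left hi.2 (hp i hi.1)
    _ ≤ ∑ i ∈ s, p i * t :=
        Finset.sum_le_sum_of_subset_of_nonneg (Finset.filter_subset _ _)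
          fun i hi _ => mul_nonneg (hp i hi) ht
    _ ≤ t := by
        rw [← Finset.sum_mul]
        exact mul_le_of_le_one_left ht hsum
  have hlarge : ∑ i ∈ s, p i * f i - t ≤ ∑ i ∈ s with t < f i, p i * f i := by
    rw [← Finset.sum_filter_add_sum_filter_not s (fun i => t < f i) fun i => p i * f i]
    linarith
  have hp' : ∀ i ∈ s.filter (t < f ·), 0 ≤ p i := fun i hi => hp i (Finset.mem_filter.1 hi).1
  calc (∑ i ∈ s, p i * f i - t) ^ 2
      ≤ (∑ i ∈ s with t < f i, p i * f i) ^ 2 := pow_le_pow_left₀ (sub_nonneg.2 hle) hlarge 2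
    _ ≤ (∑ i ∈ s with t < f i, p i) * ∑ i ∈ s with t < f i, p i * f i ^ 2 :=
        Finset.sum_sq_le_sum_mul_sum_of_sq_le_mul _ hp'
          (fun i hi => mul_nonneg (hp' i hi) (sq_nonneg _)) fun i _ => by
            rw [mul_pow, sq (p i), mul_assoc]
    _ ≤ (∑ i ∈ s with t < f i, p i) * ∑ i ∈ s, p i * f i ^ 2 := by
        refine mul_le_mul_of_nonneg_left ?_ (Finset.sum_nonneg hp')
        exact Finset.sum_le_sum_of_subset_of_nonneg (Finset.filter_subset _ _)
          fun i hi _ => mul_nonneg (hp i hi) (sq_nonneg _)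

end PowerSums

/-! ### Quasi-Bernoulli weights on words -/

section Words

variable {α : Type*} [Fintype α]

/-- The words of length `n`. -/
def words (α : Type*) [Fintype α] (n : ℕ) : Finset (List α) :=
  (List.finite_length_eq α n).toFinset

@[simp]
theorem mem_words {n : ℕ} {w : List α} : w ∈ words α n ↔ w.length = n := by
  simp [words]

theorem words_zero : words α 0 = {[]} := by
  ext w
  simp

theorem sum_words_add (n p : ℕ) (f : List α → ℝ) :
    ∑ w ∈ words α (n + p), f w = ∑ u ∈ words α n, ∑ v ∈ words α p, f (u ++ v) := by
  rw [← Finset.sum_product']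
  refine Finset.sum_bij' (fun w _ => (w.take n, w.drop n)) (fun z _ => z.1 ++ z.2) ?_ ?_ ?_ ?_ ?_
  · intro w hw
    simp only [mem_words] at hw
    simp [hw]
  · rintro ⟨u, v⟩ h
    simp only [Finset.mem_product, mem_words] at h
    simp [h.1, h.2]
  · intro w _
    simp
  · rintro ⟨u, v⟩ h
    simp only [Finset.mem_product, mem_words] at h
    simp [h.1]
  · intro w _
    simp

/-- A function on words that restricts to a probability vector on the words of each length. -/
structure IsProbabilityWeight (μ : List α → ℝ) : Prop where
  nonneg : ∀ w, 0 ≤ μ w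
  sum_eq_one : ∀ n, ∑ w ∈ words α n, μ w = 1

/-- A probability weight on words that is multiplicative up to the factor `C`: the combinatorial
shadow of a quasi-Bernoulli measure. -/
structure IsQuasiBernoulliWeight (μ : List α → ℝ) (C : ℝ) : Prop
    extends IsProbabilityWeight μ where
  mul_le : ∀ u v, μ u * μ v ≤ C * μ (u ++ v)
  append_le : ∀ u v, μ (u ++ v) ≤ C * (μ u * μ v)

/-- The partition function `∑ μ(w) ^ q`, over the words `w` of length `n` with `μ(w) > 0`. -/
def partitionSum (μ : List α → ℝ) (n : ℕ) (q : ℝ) : ℝ :=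
  ∑ w ∈ words α n with 0 < μ w, μ w ^ q

/-- The exponential moment `𝔼[b ^ (q (S_n - n d))]`, where `S_n(w) = -log_b μ(w)` and `w` is a
random word of length `n` with law `μ`. -/
def moment (μ : List α → ℝ) (b d : ℝ) (n : ℕ) (q : ℝ) : ℝ :=
  ∑ w ∈ words α n, μ w * (b ^ (n * d) * μ w) ^ (-q)

/-- The moments of `S_n - n d` grow like `b ^ (n χ(q))`, uniformly for `q ∈ [0, 1]`. -/
structure HasMomentRate (μ : List α → ℝ) (b d : ℝ) (χ : ℝ → ℝ) (C : ℝ) : Prop where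
  pos : 0 < C
  le_mul_moment : ∀ n : ℕ, ∀ q ∈ Icc (0 : ℝ) 1, b ^ (n * χ q) ≤ C * moment μ b d n q
  moment_le : ∀ n : ℕ, ∀ q ∈ Icc (0 : ℝ) 1, moment μ b d n q ≤ C * b ^ (n * χ q)

namespace IsProbabilityWeight

variable {μ : List α → ℝ} (h : IsProbabilityWeight μ)

include h

theorem le_one (w : List α) : μ w ≤ 1 := by
  rw [← h.sum_eq_one w.length]
  exact Finset.single_le_sum (fun w _ => h.nonneg w) (mem_words.2 rfl)

theorem partitionSum_one (n : ℕ) : partitionSum μ n 1 = 1 := by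
  simp only [partitionSum, Real.rpow_one]
  rw [← h.sum_eq_one n]
  exact Finset.sum_filter_of_ne fun w _ hw => lt_of_le_of_ne (h.nonneg w) hw.symm

theorem nonempty_support (n : ℕ) : ((words α n).filter (0 < μ ·)).Nonempty := by
  rw [Finset.nonempty_iff_ne_empty]
  intro hempty
  have := h.partitionSum_one n
  rw [partitionSum, hempty, Finset.sum_empty] at this
  exact zero_ne_one this

theorem partitionSum_pos (n : ℕ) (q : ℝ) : 0 < partitionSum μ n q :=
  sum_rpow_pos (fun _ hw => (Finset.mem_filter.1 hw).2) (h.nonempty_support n) q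

theorem convexOn_log_partitionSum (n : ℕ) :
    ConvexOn ℝ univ fun q => Real.log (partitionSum μ n q) :=
  convexOn_log_sum_rpow (fun _ hw => (Finset.mem_filter.1 hw).2) (h.nonempty_support n)

theorem moment_eq {b : ℝ} (hb : 0 < b) (d : ℝ) (n : ℕ) (q : ℝ) :
    moment μ b d n q = b ^ (-(n * (q * d))) * partitionSum μ n (1 - q) := by
  rw [moment, partitionSum, Finset.mul_sum, Finset.sum_filter]
  refine Finset.sum_congr rfl fun w _ => ?_
  split_ifs with hw
  · rw [Real.mul_rpow (Real.rpow_pos_of_pos hb _).le hw.le, ← Real.rpow_mul hb.le, sub_eq_add_neg,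
      Real.rpow_add hw, Real.rpow_one]
    ring_nf
  · rw [le_antisymm (not_lt.1 hw) (h.nonneg w), zero_mul]

theorem sq_moment_sub_le {b : ℝ} (hb : 1 < b) (d s : ℝ) (n : ℕ) {q : ℝ} (hq : 0 < q)
    (hle : b ^ (q * s) ≤ moment μ b d n q) :
    (moment μ b d n q - b ^ (q * s)) ^ 2 ≤
      (∑ w ∈ words α n with μ w ≤ b ^ (-(n * d + s)), μ w) * moment μ b d n (2 * q) := by
  have hb0 : 0 < b := zero_lt_one.trans hb
  have hbd : 0 < b ^ (n * d) := Real.rpow_pos_of_pos hb0 _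
  have sq_term : ∀ w, ((b ^ (n * d) * μ w) ^ (-q)) ^ 2 = (b ^ (n * d) * μ w) ^ (-(2 * q)) :=
    fun w => by
      rw [← Real.rpow_natCast, ← Real.rpow_mul (mul_nonneg hbd.le (h.nonneg w))]
      push_cast
      ring_nf
  have light_of_large : ∀ w, b ^ (q * s) < (b ^ (n * d) * μ w) ^ (-q) →
      μ w ≤ b ^ (-(n * d + s)) := fun w hw => by
    rw [neg_add, Real.rpow_add hb0, Real.rpow_neg hb0.le, le_inv_mul_iff₀ hbd]
    by_contra! hlt
    refine hw.not_ge ?_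
    calc (b ^ (n * d) * μ w) ^ (-q) ≤ (b ^ (-s)) ^ (-q) :=
          Real.rpow_le_rpow_of_nonpos (Real.rpow_pos_of_pos hb0 _) hlt.le (neg_nonpos.2 hq.le)
      _ = b ^ (q * s) := by rw [← Real.rpow_mul hb0.le]; ring_nf
  have hpz := paley_zygmund_sum (fun w _ => h.nonneg w) (h.sum_eq_one n).le
    (Real.rpow_pos_of_pos hb0 (q * s)).le hle
  simp only [sq_term] at hpz
  refine hpz.trans (mul_le_mul_of_nonneg_right ?_ ?_)
  · exact Finset.sum_le_sum_of_subset_of_nonneg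
      (Finset.monotone_filter_right _ fun w _ => light_of_large w) fun w _ _ => h.nonneg w
  · exact Finset.sum_nonneg fun w _ =>
      mul_nonneg (h.nonneg w) (Real.rpow_nonneg (mul_nonneg hbd.le (h.nonneg w)) _)

end IsProbabilityWeight

namespace IsQuasiBernoulliWeight

variable {μ : List α → ℝ} {C : ℝ} (h : IsQuasiBernoulliWeight μ C)

include h

theorem one_le : 1 ≤ C := by
  have hnil : μ [] = 1 := by simpa only [words_zero, Finset.sum_singleton] using h.sum_eq_one 0
  simpa [hnil] using h.mul_le [] []

theorem pos : 0 < C := zero_lt_one.trans_le h.one_le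

theorem append_pos_iff {u v : List α} : 0 < μ (u ++ v) ↔ 0 < μ u ∧ 0 < μ v := by
  constructor
  · intro huv
    have hmul : 0 < μ u * μ v := pos_of_mul_pos_right (huv.trans_le (h.append_le u v)) h.pos.le
    exact ⟨pos_of_mul_pos_left hmul (h.nonneg v), pos_of_mul_pos_right hmul (h.nonneg u)⟩
  · rintro ⟨hu, hv⟩
    exact pos_of_mul_pos_right ((mul_pos hu hv).trans_le (h.mul_le u v)) h.pos.le

theorem partitionSum_add (n p : ℕ) (q : ℝ) :
    partitionSum μ (n + p) q =
      ∑ u ∈ words α n with 0 < μ u, ∑ v ∈ words α p with 0 < μ v, μ (u ++ v) ^ q := by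
  simp only [partitionSum, Finset.sum_filter, sum_words_add, h.append_pos_iff, ite_and,
    Finset.sum_ite_irrel, Finset.sum_const_zero]

theorem partitionSum_add_le (n p : ℕ) (q : ℝ) :
    partitionSum μ (n + p) q ≤ C ^ |q| * (partitionSum μ n q * partitionSum μ p q) := by
  rw [h.partitionSum_add, partitionSum, partitionSum, Finset.sum_mul_sum]
  simp only [Finset.mul_sum]
  refine Finset.sum_le_sum fun u hu => Finset.sum_le_sum fun v hv => ?_
  have hu := (Finset.mem_filter.1 hu).2
  have hv := (Finset.mem_filter.1 hv).2
  rw [← Real.mul_rpow hu.le hv.le]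
  exact rpow_le_rpow_abs_mul_rpow (h.append_pos_iff.2 ⟨hu, hv⟩) (mul_pos hu hv) h.pos.le
    (h.append_le u v) (h.mul_le u v) q

theorem partitionSum_mul_le (n p : ℕ) (q : ℝ) :
    partitionSum μ n q * partitionSum μ p q ≤ C ^ |q| * partitionSum μ (n + p) q := by
  rw [h.partitionSum_add, partitionSum, partitionSum, Finset.sum_mul_sum]
  simp only [Finset.mul_sum]
  refine Finset.sum_le_sum fun u hu => Finset.sum_le_sum fun v hv => ?_
  have hu := (Finset.mem_filter.1 hu).2
  have hv := (Finset.mem_filter.1 hv).2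
  rw [← Real.mul_rpow hu.le hv.le]
  exact rpow_le_rpow_abs_mul_rpow (mul_pos hu hv) (h.append_pos_iff.2 ⟨hu, hv⟩) h.pos.le
    (h.mul_le u v) (h.append_le u v) q

theorem exists_log_partitionSum_approx (q : ℝ) :
    ∃ L : ℝ, ∀ n : ℕ, |Real.log (partitionSum μ n q) - n * L| ≤ |q| * Real.log C := by
  refine exists_linear_approx_of_almost_additive fun n p => ?_
  have hn := h.partitionSum_pos n q
  have hp := h.partitionSum_pos p q
  rw [← Real.log_mul hn.ne' hp.ne', ← Real.log_rpow h.pos]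
  exact abs_log_sub_log_le (h.partitionSum_pos _ q) (mul_pos hn hp) (Real.rpow_pos_of_pos h.pos _)
    (h.partitionSum_add_le n p q) (h.partitionSum_mul_le n p q)

end IsQuasiBernoulliWeight

end Words

/-! ### Doubling rates -/

/-- A convex function vanishing at `0`, positive on `(0, 1]`, with the doubling property there. -/
structure IsDoublingRate (χ : ℝ → ℝ) (K : ℝ) : Prop where
  convex : ConvexOn ℝ univ χ
  zero : χ 0 = 0
  pos : ∀ q ∈ Ioc (0 : ℝ) 1, 0 < χ q
  doubling : ∀ q ∈ Ioc (0 : ℝ) 1, χ q ≤ K * χ (q / 2)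

/-- `1 / χ⁻¹(1 / t)`, where `χ⁻¹` is the inverse of `χ` on `[0, 1]`: the scale `θ` of the rate `χ`,
meaningful for `t ≥ 1 / χ(1)`. -/
def rateScale (χ : ℝ → ℝ) (t : ℝ) : ℝ := 1 / Function.invFunOn χ (Icc 0 1) (1 / t)

/-- The value at `b ^ (-n)` of the gauge `t ^ d * b ^ (-a θ(log_b (1 / t)))`. -/
def gaugeSeq (χ : ℝ → ℝ) (b d a : ℝ) (n : ℕ) : ℝ := b ^ (-(n * d + a * rateScale χ n))

theorem gaugeSeq_pos {b : ℝ} (hb : 0 < b) (χ : ℝ → ℝ) (d a : ℝ) (n : ℕ) :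
    0 < gaugeSeq χ b d a n :=
  Real.rpow_pos_of_pos hb _

namespace IsDoublingRate

variable {χ : ℝ → ℝ} {K : ℝ} (h : IsDoublingRate χ K)

include h

theorem map_mul_le {s : ℝ} (hs0 : 0 ≤ s) (hs1 : s ≤ 1) (q : ℝ) : χ (s * q) ≤ s * χ q := by
  have := h.convex.2 (mem_univ q) (mem_univ 0) hs0 (sub_nonneg.2 hs1) (by ring)
  simpa [h.zero] using this

theorem strictMonoOn : StrictMonoOn χ (Icc 0 1) := by
  intro x hx y hy hxy
  have hy0 : 0 < y := hx.1.trans_lt hxy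
  calc χ x = χ (x / y * y) := by rw [div_mul_cancel₀ _ hy0.ne']
    _ ≤ x / y * χ y := h.map_mul_le (div_nonneg hx.1 hy0.le) ((div_le_one hy0).2 hxy.le) y
    _ < χ y := mul_lt_of_lt_one_left (h.pos y ⟨hy0, hy.2⟩) ((div_lt_one hy0).2 hxy)

theorem bijOn : BijOn χ (Icc 0 1) (Icc 0 (χ 1)) := by
  refine ⟨?_, h.strictMonoOn.injOn, ?_⟩
  · simpa only [h.zero] using h.strictMonoOn.monotoneOn.mapsTo_Icc
  · have hc : ContinuousOn χ (Icc 0 1) := (h.convex.continuousOn isOpen_univ).mono (subset_univ _)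
    simpa only [SurjOn, h.zero] using intermediate_value_Icc zero_le_one hc

theorem one_pos : 0 < χ 1 := h.pos 1 ⟨zero_lt_one, le_rfl⟩

theorem constant_pos : 0 < K := by
  by_contra! hK
  have hhalf := h.pos (1 / 2) (by norm_num)
  exact (h.one_pos.trans_le (h.doubling 1 ⟨zero_lt_one, le_rfl⟩)).not_ge
    (mul_nonpos_of_nonpos_of_nonneg hK hhalf.le)

theorem map_pow_two_mul_le {q : ℝ} (hq : 0 < q) (j : ℕ) (hj : 2 ^ j * q ≤ 1) :
    χ (2 ^ j * q) ≤ K ^ j * χ q := by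
  induction j with
  | zero => simp
  | succ j ih =>
    have hhalf : 2 ^ (j + 1) * q / 2 = 2 ^ j * q := by ring
    have hle : 2 ^ j * q ≤ 1 := by linarith [mul_pos (pow_pos two_pos j) hq]
    calc χ (2 ^ (j + 1) * q) ≤ K * χ (2 ^ j * q) := by
          simpa only [hhalf] using h.doubling (2 ^ (j + 1) * q) ⟨by positivity, hj⟩
      _ ≤ K * (K ^ j * χ q) := mul_le_mul_of_nonneg_left (ih hle) h.constant_pos.le
      _ = K ^ (j + 1) * χ q := by ring

theorem pow_two_mul_map_le (q : ℝ) (j : ℕ) : 2 ^ j * χ q ≤ χ (2 ^ j * q) := by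
  have := h.map_mul_le (s := ((2 : ℝ) ^ j)⁻¹) (by positivity)
    (inv_le_one_of_one_le₀ (one_le_pow₀ one_le_two)) (2 ^ j * q)
  rwa [inv_mul_cancel_left₀ (by positivity), le_inv_mul_iff₀ (by positivity)] at this

theorem exists_mul_pow_le :
    ∃ B > 0, ∃ k : ℕ, ∀ q ∈ Ioc (0 : ℝ) 1, B * q ^ k ≤ χ q := by
  obtain ⟨k, hk⟩ := pow_unbounded_of_one_lt K (one_lt_two : (1 : ℝ) < 2)
  refine ⟨χ 1 / 2 ^ k, div_pos h.one_pos (by positivity), k, fun q hq => ?_⟩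
  obtain ⟨j, hlt, hle⟩ := exists_nat_pow_near_of_lt_one hq.1 hq.2 (one_half_pos (α := ℝ))
    one_half_lt_one
  set r : ℝ := (1 / 2) ^ (j + 1)
  have hr : 2 ^ (j + 1) * r = 1 := by simp [r]
  have hr0 : 0 < r := by positivity
  have hq2 : q ≤ 2 * r := hle.trans_eq (by simp only [r]; ring)
  have hKr : K ^ (j + 1) * r ^ k ≤ 1 := calc
    K ^ (j + 1) * r ^ k ≤ (2 ^ k) ^ (j + 1) * r ^ k := by
      gcongr
      exact h.constant_pos.le
    _ = (2 ^ (j + 1) * r) ^ k := by rw [mul_pow, ← pow_mul, mul_comm k, pow_mul]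
    _ = 1 := by rw [hr, one_pow]
  have hχr : χ 1 ≤ K ^ (j + 1) * χ r := by
    simpa only [hr] using h.map_pow_two_mul_le hr0 (j + 1) hr.le
  have hrmem : r ∈ Ioc (0 : ℝ) 1 := ⟨hr0, hlt.le.trans hq.2⟩
  calc χ 1 / 2 ^ k * q ^ k ≤ χ 1 / 2 ^ k * (2 * r) ^ k := by
        gcongr
        · exact (div_pos h.one_pos (by positivity)).le
        · exact hq.1.le
    _ = χ 1 * r ^ k := by rw [mul_pow]; field_simp
    _ ≤ K ^ (j + 1) * χ r * r ^ k := mul_le_mul_of_nonneg_right hχr (by positivity)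
    _ = K ^ (j + 1) * r ^ k * χ r := by ring
    _ ≤ χ r := mul_le_of_le_one_left (h.pos r hrmem).le hKr
    _ ≤ χ q := h.strictMonoOn.monotoneOn (Ioc_subset_Icc_self hrmem) (Ioc_subset_Icc_self hq) hlt.le

section Scale

variable {t : ℝ} (ht : 1 / χ 1 ≤ t)

include ht

theorem pos_of_le : 0 < t := (one_div_pos.2 h.one_pos).trans_le ht

theorem one_div_mem_image : 1 / t ∈ χ '' Icc 0 1 := by
  rw [h.bijOn.image_eq]
  exact ⟨(one_div_pos.2 (h.pos_of_le ht)).le, (one_div_le (h.pos_of_le ht) h.one_pos).2 ht⟩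

theorem map_one_div_rateScale : χ (1 / rateScale χ t) = 1 / t := by
  rw [rateScale, one_div_one_div]
  exact Function.invFunOn_eq (h.one_div_mem_image ht)

theorem one_div_rateScale_mem : 1 / rateScale χ t ∈ Ioc (0 : ℝ) 1 := by
  have hmap := h.map_one_div_rateScale ht
  have hmem : 1 / rateScale χ t ∈ Icc (0 : ℝ) 1 := by
    rw [rateScale, one_div_one_div]
    exact Function.invFunOn_mem (h.one_div_mem_image ht)
  refine ⟨hmem.1.lt_of_ne fun h0 => ?_, hmem.2⟩
  rw [← h0, h.zero] at hmap
  exact (one_div_pos.2 (h.pos_of_le ht)).ne hmap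

theorem rateScale_pos : 0 < rateScale χ t := one_div_pos.1 (h.one_div_rateScale_mem ht).1

theorem rateScale_le_mul {s : ℝ} (hts : t ≤ s) : rateScale χ s ≤ s / t * rateScale χ t := by
  have ht0 := h.pos_of_le ht
  have hs0 := ht0.trans_le hts
  have hθt := h.rateScale_pos ht
  have hq := h.one_div_rateScale_mem ht
  have hts1 : t / s ≤ 1 := (div_le_one hs0).2 hts
  have hmap : χ (t / s * (1 / rateScale χ t)) ≤ χ (1 / rateScale χ s) := calc
    _ ≤ t / s * χ (1 / rateScale χ t) := h.map_mul_le (by positivity) hts1 _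
    _ = χ (1 / rateScale χ s) := by
      rw [h.map_one_div_rateScale ht, h.map_one_div_rateScale (ht.trans hts)]
      field_simp
  have hle := (h.strictMonoOn.le_iff_le
    ⟨by positivity, (mul_le_of_le_one_left hq.1.le hts1).trans hq.2⟩
    (Ioc_subset_Icc_self (h.one_div_rateScale_mem (ht.trans hts)))).1 hmap
  rw [le_one_div (by positivity) (h.rateScale_pos (ht.trans hts))] at hle
  exact hle.trans_eq (by field_simp)

theorem lt_rateScale {M : ℝ} (hM : 1 ≤ M) (hlt : 1 / t < χ (1 / M)) : M < rateScale χ t := by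
  have hM0 : 0 < M := zero_lt_one.trans_le hM
  rw [← h.map_one_div_rateScale ht] at hlt
  exact (one_div_lt_one_div (h.rateScale_pos ht) hM0).1 <| (h.strictMonoOn.lt_iff_lt
    (Ioc_subset_Icc_self (h.one_div_rateScale_mem ht))
    ⟨(one_div_pos.2 hM0).le, (div_le_one hM0).2 hM⟩).1 hlt

theorem pow_two_le_mul_map (j : ℕ) : 2 ^ j ≤ t * χ (2 ^ j / rateScale χ t) := by
  have := h.pow_two_mul_map_le (1 / rateScale χ t) j
  rwa [h.map_one_div_rateScale ht, mul_one_div, mul_one_div, div_le_iff₀' (h.pos_of_le ht)] at this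

theorem mul_map_le_pow {j : ℕ} (hj : 2 ^ j ≤ rateScale χ t) :
    t * χ (2 ^ j / rateScale χ t) ≤ K ^ j := by
  have hθ := h.rateScale_pos ht
  have := h.map_pow_two_mul_le (one_div_pos.2 hθ) j (by rwa [mul_one_div, div_le_one hθ])
  rwa [h.map_one_div_rateScale ht, mul_one_div, mul_one_div, le_div_iff₀' (h.pos_of_le ht)] at this

end Scale

theorem tendsto_rateScale : Tendsto (rateScale χ) atTop atTop := by
  refine tendsto_atTop.2 fun M => ?_
  have hM : 0 < χ (1 / max M 1) :=
    h.pos _ ⟨by positivity, (div_le_one (by positivity)).2 (le_max_right _ _)⟩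
  filter_upwards [eventually_ge_atTop (1 / χ 1),
    tendsto_inv_atTop_zero.eventually_lt_const hM] with t ht hlt
  exact (le_max_left M 1).trans (h.lt_rateScale ht (le_max_right _ _) (by rwa [one_div])).le

theorem exists_le_mul_rateScale_pow :
    ∃ B > 0, ∃ k : ℕ, ∀ t, 1 / χ 1 ≤ t → t ≤ B * rateScale χ t ^ k := by
  obtain ⟨B, hB, k, hpow⟩ := h.exists_mul_pow_le
  refine ⟨B⁻¹, inv_pos.2 hB, k, fun t ht => ?_⟩
  have ht0 := h.pos_of_le ht
  have hθ := h.rateScale_pos ht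
  have := hpow _ (h.one_div_rateScale_mem ht)
  rwa [h.map_one_div_rateScale ht, one_div_pow, mul_one_div,
    div_le_div_iff₀ (by positivity) ht0, one_mul, ← le_inv_mul_iff₀ hB] at this

theorem eventually_add_rateScale_le {a a' s : ℝ} (ha : 0 < a) (haa' : a < a') (hs : 0 ≤ s) (R : ℝ) :
    ∀ᶠ t in atTop, R + a * rateScale χ (s + t) ≤ a' * rateScale χ t := by
  have hδ : 0 < a' - a := sub_pos.2 haa'
  filter_upwards [eventually_ge_atTop (1 / χ 1), eventually_ge_atTop (2 * a * s / (a' - a)),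
    h.tendsto_rateScale.eventually_ge_atTop (2 * R / (a' - a))] with t ht hts hθR
  have ht0 := h.pos_of_le ht
  have hθ := h.rateScale_pos ht
  rw [div_le_iff₀ hδ] at hts hθR
  have hshift : a * (s / t) ≤ (a' - a) / 2 := by
    rw [mul_div_assoc', div_le_iff₀ ht0]
    linarith
  have hscale : rateScale χ (s + t) ≤ (s / t + 1) * rateScale χ t := by
    simpa only [add_div, div_self ht0.ne'] using h.rateScale_le_mul ht (le_add_of_nonneg_left hs)
  calc R + a * rateScale χ (s + t)
      ≤ (a' - a) / 2 * rateScale χ t + a * ((s / t + 1) * rateScale χ t) := by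
        gcongr
        linarith
    _ = ((a' - a) / 2 + a * (s / t) + a) * rateScale χ t := by ring
    _ ≤ a' * rateScale χ t := by
        gcongr
        linarith

theorem eventually_pow_le_rpow_rateScale {b η : ℝ} (hb : 1 < b) (hη : 0 < η) (p : ℕ) :
    ∀ᶠ t in atTop, (t + 1) ^ p ≤ b ^ (η * rateScale χ t) := by
  obtain ⟨B, -, k, hpow⟩ := h.exists_le_mul_rateScale_pow
  have hexp := (tendsto_exp_mul_div_rpow_atTop ((k * p : ℕ) : ℝ) (Real.log b * η)
    (mul_pos (Real.log_pos hb) hη)).comp h.tendsto_rateScale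
  filter_upwards [hexp.eventually_ge_atTop ((2 * B) ^ p), eventually_ge_atTop (1 / χ 1),
    eventually_ge_atTop 1] with t hle ht ht1
  have hθ := h.rateScale_pos ht
  simp only [Function.comp_apply, Real.rpow_natCast] at hle
  rw [le_div_iff₀ (by positivity)] at hle
  calc (t + 1) ^ p ≤ (2 * B * rateScale χ t ^ k) ^ p := by
        gcongr
        linarith [hpow t ht]
    _ = (2 * B) ^ p * rateScale χ t ^ (k * p) := by rw [mul_pow, pow_mul]
    _ ≤ b ^ (η * rateScale χ t) := by
        rwa [Real.rpow_def_of_pos (zero_lt_one.trans hb), ← mul_assoc]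

theorem eventually_mul_gaugeSeq_le_gaugeSeq_add {a a' b C : ℝ} (hb : 1 < b) (ha : 0 < a)
    (haa' : a < a') (hC : 0 < C) (d : ℝ) (N : ℕ) :
    ∀ᶠ n in atTop, C * gaugeSeq χ b d a' n ≤ gaugeSeq χ b d a (N + n) := by
  have hb0 : 0 < b := zero_lt_one.trans hb
  filter_upwards [tendsto_natCast_atTop_atTop.eventually
    (h.eventually_add_rateScale_le ha haa' N.cast_nonneg (Real.logb b C + N * d))] with n hn
  rw [gaugeSeq, gaugeSeq]
  nth_rewrite 1 [← Real.rpow_logb hb0 hb.ne' hC]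
  rw [← Real.rpow_add hb0]
  refine Real.rpow_le_rpow_of_exponent_le hb.le ?_
  push_cast
  linarith

theorem eventually_pow_mul_gaugeSeq_le {a a' b : ℝ} (hb : 1 < b) (haa' : a < a') (d : ℝ) (p : ℕ) :
    ∀ᶠ n : ℕ in atTop, ((n : ℝ) + 1) ^ p * gaugeSeq χ b d a' n ≤ gaugeSeq χ b d a n := by
  have hb0 : 0 < b := zero_lt_one.trans hb
  filter_upwards [tendsto_natCast_atTop_atTop.eventually
    (h.eventually_pow_le_rpow_rateScale hb (sub_pos.2 haa') p)] with n hn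
  calc ((n : ℝ) + 1) ^ p * gaugeSeq χ b d a' n
      ≤ b ^ ((a' - a) * rateScale χ n) * gaugeSeq χ b d a' n :=
        mul_le_mul_of_nonneg_right hn (gaugeSeq_pos hb0 χ d a' n).le
    _ = gaugeSeq χ b d a n := by
        rw [gaugeSeq, gaugeSeq, ← Real.rpow_add hb0]
        ring_nf

end IsDoublingRate

/-! ### Light words -/

section Words

variable {α : Type*} [Fintype α] {μ : List α → ℝ} {χ : ℝ → ℝ} {b d a C K : ℝ}

theorem exists_rpow_mul_pow_two_lt (hb : 1 < b) (ha : a < 1) (hC : 0 < C) :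
    ∃ j : ℕ, b ^ (a * 2 ^ j) < C⁻¹ * b ^ ((2 : ℝ) ^ j) := by
  have hb0 : 0 < b := zero_lt_one.trans hb
  have hlarge : Tendsto (fun j : ℕ => b ^ ((1 - a) * (2 : ℝ) ^ j)) atTop atTop :=
    (tendsto_rpow_atTop_of_base_gt_one b hb).comp
      ((tendsto_pow_atTop_atTop_of_one_lt one_lt_two).const_mul_atTop (sub_pos.2 ha))
  obtain ⟨j, hj⟩ := (hlarge.eventually_gt_atTop C).exists
  refine ⟨j, ?_⟩
  rw [lt_inv_mul_iff₀ hC, ← lt_div_iff₀ (Real.rpow_pos_of_pos hb0 _), ← Real.rpow_sub hb0]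
  convert hj using 2
  ring

/-- The second moment method at the parameters `q = 2 ^ j / θ(n)` and `2 q`, where the exponential
moments of `S_n - n d` are comparable to constants because `χ(1 / θ(n)) = 1 / n`. -/
theorem sq_sub_le_sum_light_words_mul (h : IsProbabilityWeight μ) (hχ : IsDoublingRate χ K)
    (hmom : HasMomentRate μ b d χ C) (hb : 1 < b) {n j : ℕ} (hn : 1 / χ 1 ≤ n)
    (hθj : 2 ^ (j + 1) ≤ rateScale χ n) (hj : b ^ (a * 2 ^ j) ≤ C⁻¹ * b ^ ((2 : ℝ) ^ j)) :
    (C⁻¹ * b ^ ((2 : ℝ) ^ j) - b ^ (a * 2 ^ j)) ^ 2 ≤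
      (∑ w ∈ words α n with μ w ≤ gaugeSeq χ b d a n, μ w) * (C * b ^ K ^ (j + 1)) := by
  have hC := hmom.pos
  have hθ := hχ.rateScale_pos hn
  set q := 2 ^ j / rateScale χ n with hq
  have hq0 : 0 < q := by positivity
  have h2q : 2 * q = 2 ^ (j + 1) / rateScale χ n := by rw [hq, pow_succ', mul_div_assoc]
  have h2q1 : 2 * q ≤ 1 := by rwa [h2q, div_le_one hθ]
  have hqs : q * (a * rateScale χ n) = a * 2 ^ j := by rw [hq]; field_simp
  have hlower : C⁻¹ * b ^ ((2 : ℝ) ^ j) ≤ moment μ b d n q := by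
    rw [inv_mul_le_iff₀ hC]
    exact (Real.rpow_le_rpow_of_exponent_le hb.le (hχ.pow_two_le_mul_map hn j)).trans
      (hmom.le_mul_moment n q ⟨hq0.le, by linarith⟩)
  have hupper : moment μ b d n (2 * q) ≤ C * b ^ K ^ (j + 1) := by
    refine (hmom.moment_le n (2 * q) ⟨by positivity, h2q1⟩).trans ?_
    rw [h2q]
    gcongr
    · exact hb.le
    · exact hχ.mul_map_le_pow hn hθj
  have hpz := h.sq_moment_sub_le hb d (a * rateScale χ n) n hq0
    (by rw [hqs]; exact hj.trans hlower)
  rw [hqs] at hpz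
  calc (C⁻¹ * b ^ ((2 : ℝ) ^ j) - b ^ (a * 2 ^ j)) ^ 2
      ≤ (moment μ b d n q - b ^ (a * 2 ^ j)) ^ 2 :=
        pow_le_pow_left₀ (sub_nonneg.2 hj) (sub_le_sub_right hlower _) 2
    _ ≤ _ := hpz
    _ ≤ _ := mul_le_mul_of_nonneg_left hupper (Finset.sum_nonneg fun w _ => h.nonneg w)

theorem exists_le_sum_light_words (h : IsProbabilityWeight μ) (hχ : IsDoublingRate χ K)
    (hmom : HasMomentRate μ b d χ C) (hb : 1 < b) (ha : a < 1) :
    ∃ c > 0, ∀ᶠ n in atTop, c ≤ ∑ w ∈ words α n with μ w ≤ gaugeSeq χ b d a n, μ w := by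
  obtain ⟨j, hj⟩ := exists_rpow_mul_pow_two_lt hb ha hmom.pos
  have hM : 0 < C * b ^ K ^ (j + 1) :=
    mul_pos hmom.pos (Real.rpow_pos_of_pos (zero_lt_one.trans hb) _)
  refine ⟨(C⁻¹ * b ^ ((2 : ℝ) ^ j) - b ^ (a * 2 ^ j)) ^ 2 / (C * b ^ K ^ (j + 1)),
    div_pos (pow_pos (sub_pos.2 hj) 2) hM, ?_⟩
  filter_upwards [tendsto_natCast_atTop_atTop.eventually_ge_atTop (1 / χ 1),
    (hχ.tendsto_rateScale.comp tendsto_natCast_atTop_atTop).eventually_ge_atTop (2 ^ (j + 1))]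
    with n hn hθj
  rw [div_le_iff₀ hM]
  exact sq_sub_le_sum_light_words_mul h hχ hmom hb hn hθj hj.le

end Words

/-! ### A conditional Borel–Cantelli lemma -/

theorem ae_frequently_mem_of_forall_mul_le_inter {Ω : Type*} {m₀ : MeasurableSpace Ω}
    {μ : Measure Ω} [IsFiniteMeasure μ] (ℱ : Filtration ℕ m₀) {A : ℕ → Set Ω}
    (hA : ∀ n, MeasurableSet[ℱ n] (A n)) {c : ℝ} (hc : 0 < c)
    (hcond : ∀ N, ∃ n ≥ N, ∀ B, MeasurableSet[ℱ N] B → c * μ.real B ≤ μ.real (B ∩ A n)) :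
    ∀ᵐ x ∂μ, ∃ᶠ n in atTop, x ∈ A n := by
  simp only [frequently_atTop]
  refine ae_all_iff.2 fun N₀ => ?_
  set B : ℕ → Set Ω := fun N => ⋂ n ∈ Finset.Icc N₀ N, (A n)ᶜ with hB
  have mem_B : ∀ N x, x ∈ B N ↔ ∀ n, N₀ ≤ n → n ≤ N → x ∉ A n := fun N x => by simp [hB]
  have hBmeas : ∀ N, MeasurableSet[ℱ N] (B N) := fun N =>
    Finset.measurableSet_biInter _ fun n hn =>
      (ℱ.mono (Finset.mem_Icc.1 hn).2 _ (hA n)).compl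
  have hBanti : Antitone B := fun N N' hN x hx =>
    (mem_B N x).2 fun n h₁ h₂ => (mem_B N' x).1 hx n h₁ (h₂.trans hN)
  have hshrink : ∀ N ≥ N₀, μ.real (⋂ N, B N) ≤ (1 - c) * μ.real (B N) := fun N hN => by
    obtain ⟨n, hn, hle⟩ := hcond N
    have hsub : μ.real (⋂ N, B N) ≤ μ.real (B N \ A n) := measureReal_mono fun x hx =>
      ⟨mem_iInter.1 hx N, (mem_B n x).1 (mem_iInter.1 hx n) n (hN.trans hn) le_rfl⟩
    have hsplit := measureReal_inter_add_sdiff (μ := μ) (s := B N) (ℱ.le n _ (hA n))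
    linarith [hle (B N) (hBmeas N)]
  have hlim : Tendsto (fun N => μ.real (B N)) atTop (𝓝 (μ.real (⋂ N, B N))) :=
    (ENNReal.tendsto_toReal (measure_ne_top _ _)).comp <|
      tendsto_measure_iInter_atTop (fun N => (ℱ.le N _ (hBmeas N)).nullMeasurableSet) hBanti
        ⟨0, measure_ne_top _ _⟩
  have hle : μ.real (⋂ N, B N) ≤ (1 - c) * μ.real (⋂ N, B N) :=
    ge_of_tendsto (hlim.const_mul (1 - c)) ((eventually_ge_atTop N₀).mono hshrink)
  have hzero : μ.real (⋂ N, B N) = 0 :=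
    le_antisymm (nonpos_of_mul_nonpos_right (by linarith) hc) measureReal_nonneg
  refine measure_mono_null (fun x hx => mem_iInter.2 fun N => (mem_B N x).2 fun n hn _ hxA => ?_)
    ((measureReal_eq_zero_iff).1 hzero)
  exact hx ⟨n, hn, hxA⟩

/-! ### Cubes and codings -/

theorem measurableSet_forall_mem {ι : Type*} [Countable ι] {s : ι → Set ℝ}
    (hs : ∀ i, MeasurableSet (s i)) : MeasurableSet {x : EuclideanSpace ℝ ι | ∀ i, x i ∈ s i} := by
  rw [Set.ofPred_forall]
  exact MeasurableSet.iInter fun i => (hs i).preimage (by fun_prop)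

section Cubes

variable {ℓ D n : ℕ} {x : EuclideanSpace ℝ (Fin D)} {Q : Set (EuclideanSpace ℝ (Fin D))}

theorem measurableSet_unitCube : MeasurableSet (unitCube D) :=
  measurableSet_forall_mem fun _ => measurableSet_Ico

theorem measurableSet_of_mem_adicCubes (hQ : Q ∈ adicCubes ℓ D n) : MeasurableSet Q := by
  obtain ⟨k, -, rfl⟩ := hQ
  exact measurableSet_forall_mem fun _ => measurableSet_Ico

theorem mem_adicCube_iff (hℓ : 0 < ℓ) {k : Fin D → ℕ} :
    x ∈ adicCube ℓ D n k ↔ ∀ i, (k i : ℝ) ≤ (ℓ : ℝ) ^ n * x i ∧ (ℓ : ℝ) ^ n * x i < k i + 1 := by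
  have hp : (0 : ℝ) < (ℓ : ℝ) ^ n := by positivity
  exact forall_congr' fun i => by rw [mem_Ico, div_le_iff₀' hp, lt_div_iff₀' hp]

theorem eq_cubeAt_of_mem (hℓ : 0 < ℓ) (hQ : Q ∈ adicCubes ℓ D n) (hx : x ∈ Q) :
    Q = cubeAt ℓ D n x := by
  obtain ⟨k, -, rfl⟩ := hQ
  rw [mem_adicCube_iff hℓ] at hx
  rw [cubeAt]
  congr 1
  funext i
  exact ((Nat.floor_eq_iff ((k i).cast_nonneg.trans (hx i).1)).2 (hx i)).symm

theorem mem_cubeAt (hℓ : 0 < ℓ) (hx : x ∈ unitCube D) : x ∈ cubeAt ℓ D n x :=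
  (mem_adicCube_iff hℓ).2 fun i =>
    ⟨Nat.floor_le (mul_nonneg (by positivity) (hx i).1), Nat.lt_floor_add_one _⟩

theorem cubeAt_mem_adicCubes (hℓ : 0 < ℓ) (hx : x ∈ unitCube D) :
    cubeAt ℓ D n x ∈ adicCubes ℓ D n := by
  refine ⟨_, fun i => ?_, rfl⟩
  have hp : (0 : ℝ) < (ℓ : ℝ) ^ n := by positivity
  rw [Nat.floor_lt (mul_nonneg hp.le (hx i).1)]
  push_cast
  exact mul_lt_of_lt_one_right hp (hx i).2

theorem cubeAt_zero (hx : x ∈ unitCube D) : cubeAt ℓ D 0 x = unitCube D := by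
  have hfloor : ∀ i, ⌊x i⌋₊ = 0 := fun i => Nat.floor_eq_zero.2 (hx i).2
  simp [cubeAt, adicCube, unitCube, hfloor]

end Cubes

namespace IsAdicCoding

variable {ℓ D : ℕ} {I : List (Fin (ℓ ^ D)) → Set (EuclideanSpace ℝ (Fin D))}
  (hI : IsAdicCoding ℓ D I)

include hI

theorem mem_adicCubes (w : List (Fin (ℓ ^ D))) : I w ∈ adicCubes ℓ D w.length :=
  (hI.bijOn w.length).mapsTo rfl

theorem measurableSet (w : List (Fin (ℓ ^ D))) : MeasurableSet (I w) :=
  measurableSet_of_mem_adicCubes (hI.mem_adicCubes w)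

theorem eq_cubeAt (hℓ : 0 < ℓ) {w : List (Fin (ℓ ^ D))} {x : EuclideanSpace ℝ (Fin D)}
    (hx : x ∈ I w) : I w = cubeAt ℓ D w.length x :=
  eq_cubeAt_of_mem hℓ (hI.mem_adicCubes w) hx

theorem exists_mem (hℓ : 0 < ℓ) {x : EuclideanSpace ℝ (Fin D)} (hx : x ∈ unitCube D) (n : ℕ) :
    ∃ w, w.length = n ∧ x ∈ I w := by
  obtain ⟨w, hw, hwx⟩ := (hI.bijOn n).surjOn (cubeAt_mem_adicCubes (n := n) hℓ hx)
  exact ⟨w, hw, hwx ▸ mem_cubeAt hℓ hx⟩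

theorem eq_of_mem (hℓ : 0 < ℓ) {u v : List (Fin (ℓ ^ D))} (huv : u.length = v.length)
    {x : EuclideanSpace ℝ (Fin D)} (hu : x ∈ I u) (hv : x ∈ I v) : u = v := by
  refine (hI.bijOn v.length).injOn huv rfl ?_
  rw [hI.eq_cubeAt hℓ hu, hI.eq_cubeAt hℓ hv, huv]

theorem append_subset (u v : List (Fin (ℓ ^ D))) : I (u ++ v) ⊆ I u := by
  induction v using List.reverseRecOn with
  | nil => rw [List.append_nil]
  | append_singleton v ε ih =>
    rw [← List.append_assoc]
    exact (hI.nested _ _).trans ih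

theorem subset_take (n : ℕ) (w : List (Fin (ℓ ^ D))) : I w ⊆ I (w.take n) := by
  simpa only [List.take_append_drop] using hI.append_subset (w.take n) (w.drop n)

theorem pairwiseDisjoint (hℓ : 0 < ℓ) (n : ℕ) :
    (words (Fin (ℓ ^ D)) n : Set (List (Fin (ℓ ^ D)))).PairwiseDisjoint I := by
  intro u hu v hv huv
  rw [Finset.mem_coe, mem_words] at hu hv
  exact Set.disjoint_left.2 fun x hxu hxv => huv (hI.eq_of_mem hℓ (hu.trans hv.symm) hxu hxv)

/-- The filtration generated by the cubes: an event belongs to its `n`-th σ-algebra when it is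
measurable and each cube of generation `n` is contained in it or disjoint from it. -/
def filtration : Filtration ℕ (inferInstance : MeasurableSpace (EuclideanSpace ℝ (Fin D))) where
  seq n :=
    { MeasurableSet' := fun B =>
        MeasurableSet B ∧ ∀ w : List (Fin (ℓ ^ D)), w.length = n → Disjoint (I w) B ∨ I w ⊆ B
      measurableSet_empty := ⟨.empty, fun _ _ => .inl (disjoint_empty _)⟩
      measurableSet_compl := fun B hB => ⟨hB.1.compl, fun w hw => (hB.2 w hw).symm.imp
        disjoint_compl_right_iff_subset.2 subset_compl_iff_disjoint_right.2⟩
      measurableSet_iUnion := fun B hB => ⟨.iUnion fun i => (hB i).1, fun w hw => by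
        by_cases hsub : ∃ i, I w ⊆ B i
        · exact .inr (hsub.elim fun i hi => hi.trans (subset_iUnion B i))
        · exact .inl (disjoint_iUnion_right.2 fun i =>
            ((hB i).2 w hw).resolve_right fun hi => hsub ⟨i, hi⟩)⟩ }
  mono' n p hnp B hB := ⟨hB.1, fun w hw =>
    (hB.2 (w.take n) (by rw [List.length_take, hw, min_eq_left hnp])).imp
      (fun hdisj => hdisj.mono_left (hI.subset_take n w)) (hI.subset_take n w).trans⟩
  le' _ _ hB := hB.1

theorem measurableSet_filtration_iff {n : ℕ} {B : Set (EuclideanSpace ℝ (Fin D))} :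
    MeasurableSet[hI.filtration n] B ↔
      MeasurableSet B ∧ ∀ w, w.length = n → Disjoint (I w) B ∨ I w ⊆ B :=
  Iff.rfl

theorem measurableSet_filtration_biUnion (hℓ : 0 < ℓ) {n : ℕ} {W : Finset (List (Fin (ℓ ^ D)))}
    (hW : W ⊆ words (Fin (ℓ ^ D)) n) : MeasurableSet[hI.filtration n] (⋃ w ∈ W, I w) := by
  refine hI.measurableSet_filtration_iff.2
    ⟨Finset.measurableSet_biUnion _ fun w _ => hI.measurableSet w, fun u hu => ?_⟩
  by_cases huW : u ∈ W
  · exact .inr (subset_biUnion_of_mem (u := I) huW)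
  · refine .inl (Set.disjoint_left.2 fun x hxu hx => ?_)
    obtain ⟨w, hw, hxw⟩ := mem_iUnion₂.1 hx
    have hwn := mem_words.1 (hW hw)
    exact huW (hI.eq_of_mem hℓ (hu.trans hwn.symm) hxu hxw ▸ hw)

section Measure

variable {m : Measure (EuclideanSpace ℝ (Fin D))} [IsFiniteMeasure m]

theorem measureReal_eq_sum (hℓ : 0 < ℓ) (hm : ∀ᵐ x ∂m, x ∈ unitCube D) (n : ℕ)
    {E : Set (EuclideanSpace ℝ (Fin D))} (hE : MeasurableSet E) :
    m.real E = ∑ w ∈ words (Fin (ℓ ^ D)) n, m.real (E ∩ I w) := by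
  rw [← measureReal_biUnion_finset
    ((hI.pairwiseDisjoint hℓ n).mono fun w => inter_subset_right)
    fun w _ => hE.inter (hI.measurableSet w)]
  refine measureReal_congr ?_
  filter_upwards [hm] with x hx
  obtain ⟨w, hw, hxw⟩ := hI.exists_mem hℓ hx n
  refine propext ⟨fun hxE => mem_biUnion (mem_words.2 hw) ⟨hxE, hxw⟩, fun hxE => ?_⟩
  obtain ⟨w, -, hxw⟩ := mem_iUnion₂.1 hxE
  exact hxw.1

open Classical in
theorem measureReal_eq_sum_subset (hℓ : 0 < ℓ) (hm : ∀ᵐ x ∂m, x ∈ unitCube D) {n : ℕ}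
    {B : Set (EuclideanSpace ℝ (Fin D))} (hB : MeasurableSet[hI.filtration n] B) :
    m.real B = ∑ w ∈ words (Fin (ℓ ^ D)) n with I w ⊆ B, m.real (I w) := by
  rw [hI.measureReal_eq_sum hℓ hm n hB.1, Finset.sum_filter]
  refine Finset.sum_congr rfl fun w hw => ?_
  split_ifs with hsub
  · rw [inter_eq_right.2 hsub]
  · rw [(((hB.2 w (mem_words.1 hw)).resolve_right hsub).symm).inter_eq, measureReal_empty]

open Classical in
theorem sum_measureReal_append_le (hℓ : 0 < ℓ) (hm : ∀ᵐ x ∂m, x ∈ unitCube D) {N n : ℕ}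
    {B : Set (EuclideanSpace ℝ (Fin D))} (hB : MeasurableSet[hI.filtration N] B)
    {V : Finset (List (Fin (ℓ ^ D)))} (hV : V ⊆ words (Fin (ℓ ^ D)) n)
    {W : Finset (List (Fin (ℓ ^ D)))} (hW : W ⊆ words (Fin (ℓ ^ D)) (N + n))
    (happend : ∀ u ∈ words (Fin (ℓ ^ D)) N, ∀ v ∈ V, u ++ v ∈ W) :
    ∑ u ∈ words (Fin (ℓ ^ D)) N with I u ⊆ B, ∑ v ∈ V, m.real (I (u ++ v)) ≤
      m.real (B ∩ ⋃ w ∈ W, I w) := by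
  have hmeas : MeasurableSet[hI.filtration (N + n)] (B ∩ ⋃ w ∈ W, I w) :=
    .inter (hI.filtration.mono (Nat.le_add_right N n) _ hB)
      (hI.measurableSet_filtration_biUnion hℓ hW)
  rw [hI.measureReal_eq_sum_subset hℓ hm hmeas, Finset.sum_filter, Finset.sum_filter,
    sum_words_add]
  refine Finset.sum_le_sum fun u hu => ?_
  split_ifs with hsub
  · rw [← Finset.sum_filter]
    refine Finset.sum_le_sum_of_subset_of_nonneg (fun v hv => ?_) fun _ _ _ => measureReal_nonneg
    exact Finset.mem_filter.2 ⟨hV hv, subset_inter ((hI.append_subset u v).trans hsub)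
      (subset_biUnion_of_mem (u := I) (happend u hu v hv))⟩
  · refine Finset.sum_nonneg fun v _ => ?_
    split_ifs
    exacts [measureReal_nonneg, le_rfl]

variable {C : ℝ}

theorem mul_measureReal_le_inter_light_cubes (hℓ : 0 < ℓ) (hm : ∀ᵐ x ∂m, x ∈ unitCube D)
    (h : IsQuasiBernoulliWeight (fun w => m.real (I w)) C) {N n : ℕ} {s t c : ℝ}
    (hst : C * s ≤ t)
    (hc : c ≤ ∑ v ∈ words (Fin (ℓ ^ D)) n with m.real (I v) ≤ s, m.real (I v))
    {B : Set (EuclideanSpace ℝ (Fin D))} (hB : MeasurableSet[hI.filtration N] B) :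
    c * m.real B ≤
      C * m.real (B ∩ ⋃ w ∈ {w ∈ words (Fin (ℓ ^ D)) (N + n) | m.real (I w) ≤ t}, I w) := by
  classical
  set V := {v ∈ words (Fin (ℓ ^ D)) n | m.real (I v) ≤ s}
  have hlight : ∀ u ∈ words (Fin (ℓ ^ D)) N, ∀ v ∈ V,
      u ++ v ∈ {w ∈ words (Fin (ℓ ^ D)) (N + n) | m.real (I w) ≤ t} := fun u hu v hv => by
    obtain ⟨hvn, hvs⟩ := Finset.mem_filter.1 hv
    rw [mem_words] at hu hvn
    refine Finset.mem_filter.2 ⟨mem_words.2 (by rw [List.length_append, hu, hvn]), ?_⟩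
    calc m.real (I (u ++ v)) ≤ C * (m.real (I u) * m.real (I v)) := h.append_le u v
      _ ≤ C * (1 * s) := mul_le_mul_of_nonneg_left
        (mul_le_mul (h.le_one u) hvs measureReal_nonneg zero_le_one) h.pos.le
      _ ≤ t := by rwa [one_mul]
  calc c * m.real B
      = ∑ u ∈ words (Fin (ℓ ^ D)) N with I u ⊆ B, m.real (I u) * c := by
        rw [hI.measureReal_eq_sum_subset hℓ hm hB, ← Finset.sum_mul, mul_comm]
    _ ≤ ∑ u ∈ words (Fin (ℓ ^ D)) N with I u ⊆ B, m.real (I u) * ∑ v ∈ V, m.real (I v) :=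
        Finset.sum_le_sum fun u _ => mul_le_mul_of_nonneg_left hc measureReal_nonneg
    _ ≤ C * ∑ u ∈ words (Fin (ℓ ^ D)) N with I u ⊆ B, ∑ v ∈ V, m.real (I (u ++ v)) := by
        simp only [Finset.mul_sum]
        exact Finset.sum_le_sum fun u _ => Finset.sum_le_sum fun v _ => h.mul_le u v
    _ ≤ _ := mul_le_mul_of_nonneg_left (hI.sum_measureReal_append_le hℓ hm hB
        (Finset.filter_subset _ _) (Finset.filter_subset _ _) hlight) h.pos.le

theorem ae_frequently_measureReal_cubeAt_le (hℓ : 2 ≤ ℓ) (hm : ∀ᵐ x ∂m, x ∈ unitCube D)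
    (h : IsQuasiBernoulliWeight (fun w => m.real (I w)) C) {χ : ℝ → ℝ} {K d M a : ℝ}
    (hχ : IsDoublingRate χ K) (hmom : HasMomentRate (fun w => m.real (I w)) ℓ d χ M)
    (ha0 : 0 < a) (ha1 : a < 1) :
    ∀ᵐ x ∂m, ∃ᶠ n in atTop, m.real (cubeAt ℓ D n x) ≤ gaugeSeq χ ℓ d a n := by
  have hℓ0 : 0 < ℓ := by omega
  have hb : (1 : ℝ) < ℓ := by exact_mod_cast hℓ
  obtain ⟨a', haa', ha'1⟩ := exists_between ha1
  obtain ⟨c, hc, hlight⟩ := exists_le_sum_light_words h.toIsProbabilityWeight hχ hmom hb ha'1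
  have hrec := ae_frequently_mem_of_forall_mul_le_inter (μ := m) hI.filtration
    (A := fun n => ⋃ w ∈ {w ∈ words (Fin (ℓ ^ D)) n | m.real (I w) ≤ gaugeSeq χ ℓ d a n}, I w)
    (fun n => hI.measurableSet_filtration_biUnion hℓ0 (Finset.filter_subset _ _))
    (div_pos hc h.pos) fun N => by
      obtain ⟨n, hn, hgauge⟩ := (hlight.and
        (hχ.eventually_mul_gaugeSeq_le_gaugeSeq_add hb ha0 haa' h.pos d N)).exists
      refine ⟨N + n, Nat.le_add_right N n, fun B hB => ?_⟩
      rw [div_mul_eq_mul_div, div_le_iff₀' h.pos]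
      exact hI.mul_measureReal_le_inter_light_cubes hℓ0 hm h hgauge hn hB
  filter_upwards [hrec] with x hx
  refine hx.mono fun n hxn => ?_
  obtain ⟨w, hw, hxw⟩ := mem_iUnion₂.1 hxn
  obtain ⟨hwn, hle⟩ := Finset.mem_filter.1 hw
  rwa [hI.eq_cubeAt hℓ0 hxw, mem_words.1 hwn] at hle

end Measure

end IsAdicCoding

/-! ### Densities and packing measures -/

section Packing

variable {X : Type*} [MetricSpace X] [SecondCountableTopology X] [MeasurableSpace X]
  {m : Measure X} {ψ : ℝ → ℝ≥0∞} {δ : ℝ} {E : Set X}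

theorem measure_le_packingPreAt {r : X → ℝ} (hr0 : ∀ x ∈ E, 0 < r x) (hrδ : ∀ x ∈ E, r x ≤ δ)
    (hψ : ∀ x ∈ E, m (Metric.closedBall x (5 * r x)) ≤ ψ (2 * r x)) :
    m E ≤ packingPreAt ψ δ E := by
  obtain ⟨u, huE, hdisj, hcov⟩ := Vitali.exists_disjoint_subfamily_covering_enlargement_closedBall
    E id r δ hrδ 5 (by norm_num)
  have hcount : u.Countable := hdisj.countable_of_nonempty_interior fun x hx =>
    ⟨x, mem_interior_iff_mem_nhds.2 (Metric.closedBall_mem_nhds x (hr0 x (huE hx)))⟩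
  have hinj : InjOn (fun x => (x, r x)) u := fun x _ y _ hxy => congrArg Prod.fst hxy
  have hpack : IsPacking δ E ((fun x => (x, r x)) '' u) :=
    { countable := hcount.image _
      center_mem := forall_mem_image.2 fun x hx => huE hx
      radius_pos := forall_mem_image.2 fun x hx => hr0 x (huE hx)
      radius_le := forall_mem_image.2 fun x hx => hrδ x (huE hx)
      disjoint := hinj.pairwiseDisjoint_image.2 hdisj }
  refine le_iSup₂_of_le _ hpack ?_
  rw [tsum_image (fun p : X × ℝ => ψ (2 * p.2)) hinj]
  calc m E ≤ m (⋃ x ∈ u, Metric.closedBall x (5 * r x)) := measure_mono fun x hx => by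
        obtain ⟨y, hy, hxy⟩ := hcov x hx
        exact mem_biUnion hy (hxy (Metric.mem_closedBall_self (hr0 x hx).le))
    _ ≤ ∑' x : u, m (Metric.closedBall (x : X) (5 * r x)) := measure_biUnion_le m hcount _
    _ ≤ _ := ENNReal.tsum_le_tsum fun x => hψ x (huE x.2)

theorem measure_le_packingPre
    (hψ : ∀ x ∈ E, ∃ᶠ r in 𝓝[>] 0, m (Metric.closedBall x (5 * r)) ≤ ψ (2 * r)) :
    m E ≤ packingPre ψ E := by
  refine le_iInf₂ fun δ hδ => ?_
  have hsmall : ∀ x ∈ E, ∃ r, m (Metric.closedBall x (5 * r)) ≤ ψ (2 * r) ∧ r ∈ Ioc 0 δ :=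
    fun x hx => ((hψ x hx).and_eventually (Ioc_mem_nhdsGT hδ)).exists
  choose! r hr using hsmall
  exact measure_le_packingPreAt (fun x hx => (hr x hx).2.1) (fun x hx => (hr x hx).2.2)
    fun x hx => (hr x hx).1

theorem absolutelyContinuous_packingMeasure [BorelSpace X]
    (hψ : ∀ᵐ x ∂m, ∃ᶠ r in 𝓝[>] 0, m (Metric.closedBall x (5 * r)) ≤ ψ (2 * r)) :
    m ≪ packingMeasure ψ := by
  intro s hs
  have hnull : packingOuter ψ s = 0 :=
    le_antisymm ((le_toMeasure_apply _ _ s).trans_eq hs) zero_le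
  refine le_antisymm (le_trans ?_ hnull.le) zero_le
  rw [packingOuter, OuterMeasure.ofFunction_apply]
  refine le_iInf₂ fun U hU => ?_
  set G := {x | ∃ᶠ r in 𝓝[>] 0, m (Metric.closedBall x (5 * r)) ≤ ψ (2 * r)}
  calc m s ≤ m (⋃ i, U i ∩ G) := by
        refine measure_mono_ae ?_
        filter_upwards [hψ] with x hx hxs
        obtain ⟨i, hi⟩ := mem_iUnion.1 (hU hxs)
        exact mem_iUnion.2 ⟨i, hi, hx⟩
    _ ≤ ∑' i, m (U i ∩ G) := measure_iUnion_le _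
    _ ≤ ∑' i, packingPre ψ (U i) := ENNReal.tsum_le_tsum fun i =>
        (measure_le_packingPre fun x hx => hx.2).trans (packingPre_mono ψ inter_subset_left)

end Packing

/-! ### Balls and cubes -/

theorem measure_setOf_mul_le_sum_translates_le {G : Type*} [AddGroup G] [Countable G]
    [MeasurableSpace G] [MeasurableSingletonClass G] (ν : Measure G) (F : Finset G) {t : ℝ≥0∞}
    (ht0 : t ≠ 0) (htop : t ≠ ∞) :
    ν {k | t * ν {k} ≤ ∑ e ∈ F, ν {k + e}} ≤ t⁻¹ * (F.card * ν univ) := by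
  have htotal : ∑' k, ν {k} = ν univ := by
    simpa only [lintegral_one, one_mul] using (lintegral_countable' (μ := ν) fun _ => 1).symm
  have hshift : ∀ e, ∑' k, ν {k + e} = ν univ := fun e =>
    ((Equiv.addRight e).tsum_eq fun k => ν {k}).trans htotal
  set bad : Set G := {k | t * ν {k} ≤ ∑ e ∈ F, ν {k + e}}
  calc ν bad = ν (⋃ k ∈ bad, {k}) := by rw [biUnion_of_singleton]
    _ ≤ ∑' k : bad, ν {(k : G)} := measure_biUnion_le ν bad.to_countable _
    _ ≤ ∑' k : bad, t⁻¹ * ∑ e ∈ F, ν {(k : G) + e} := ENNReal.tsum_le_tsum fun k =>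
        (ENNReal.mul_le_iff_le_inv ht0 htop).1 k.2
    _ ≤ ∑' k, t⁻¹ * ∑ e ∈ F, ν {k + e} := ENNReal.tsum_comp_le_tsum_of_injective
        Subtype.val_injective fun k => t⁻¹ * ∑ e ∈ F, ν {k + e}
    _ = t⁻¹ * (F.card * ν univ) := by
        rw [ENNReal.tsum_mul_left, Summable.tsum_finsetSum fun e _ => ENNReal.summable]
        simp only [hshift, Finset.sum_const, nsmul_eq_mul]

section Balls

variable {ℓ D : ℕ}

/-- The integer vector `⌊ℓ ^ n * x⌋`, coordinatewise; it indexes the cubes of generation `n` in the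
whole space. -/
def gridIndex (ℓ n : ℕ) (x : EuclideanSpace ℝ (Fin D)) : Fin D → ℤ := fun i => ⌊(ℓ : ℝ) ^ n * x i⌋

theorem measurable_gridIndex (n : ℕ) :
    Measurable (gridIndex ℓ n : EuclideanSpace ℝ (Fin D) → Fin D → ℤ) :=
  measurable_pi_iff.2 fun i => Int.measurable_floor.comp (by fun_prop)

theorem floor_le_floor_add_one {a b : ℝ} (h : a ≤ b + 1) : ⌊a⌋ ≤ ⌊b⌋ + 1 :=
  (Int.floor_le_floor h).trans_eq (Int.floor_add_one b)

theorem gridIndex_sub_gridIndex_mem_Icc (hℓ : 0 < ℓ) {n : ℕ} {x y : EuclideanSpace ℝ (Fin D)}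
    (hxy : dist y x ≤ ((ℓ : ℝ) ^ n)⁻¹) :
    gridIndex ℓ n y - gridIndex ℓ n x ∈ Finset.Icc (-1 : Fin D → ℤ) 1 := by
  have hp : (0 : ℝ) < (ℓ : ℝ) ^ n := by positivity
  have hcoord : ∀ i, |(ℓ : ℝ) ^ n * y i - (ℓ : ℝ) ^ n * x i| ≤ 1 := fun i => by
    have hi : |y i - x i| ≤ ((ℓ : ℝ) ^ n)⁻¹ := by
      simpa only [PiLp.sub_apply, Real.norm_eq_abs] using
        (PiLp.norm_apply_le (y - x) i).trans ((dist_eq_norm y x).symm.le.trans hxy)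
    rw [← mul_sub, abs_mul, abs_of_pos hp]
    exact (mul_le_mul_of_nonneg_left hi hp.le).trans_eq (mul_inv_cancel₀ hp.ne')
  refine Finset.mem_Icc.2 ⟨fun i => ?_, fun i => ?_⟩
  · have := floor_le_floor_add_one (sub_le_iff_le_add'.1 (abs_sub_le_iff.1 (hcoord i)).2)
    simp only [Pi.neg_apply, Pi.one_apply, Pi.sub_apply, gridIndex]
    omega
  · have := floor_le_floor_add_one (sub_le_iff_le_add'.1 (abs_sub_le_iff.1 (hcoord i)).1)
    simp only [Pi.one_apply, Pi.sub_apply, gridIndex]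
    omega

theorem closedBall_subset_biUnion_gridIndex (hℓ : 0 < ℓ) (n : ℕ) (x : EuclideanSpace ℝ (Fin D)) :
    Metric.closedBall x ((ℓ : ℝ) ^ n)⁻¹ ⊆
      ⋃ e ∈ Finset.Icc (-1 : Fin D → ℤ) 1, gridIndex ℓ n ⁻¹' {gridIndex ℓ n x + e} := fun y hy =>
  mem_biUnion (x := gridIndex ℓ n y - gridIndex ℓ n x) (gridIndex_sub_gridIndex_mem_Icc hℓ hy)
    (by simp)

theorem gridIndex_preimage_subset_cubeAt (hℓ : 0 < ℓ) (n : ℕ) {x : EuclideanSpace ℝ (Fin D)}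
    (hx : x ∈ unitCube D) : gridIndex ℓ n ⁻¹' {gridIndex ℓ n x} ⊆ cubeAt ℓ D n x := by
  refine fun y hy => (mem_adicCube_iff hℓ).2 fun i => ?_
  have hx0 : 0 ≤ (ℓ : ℝ) ^ n * x i := mul_nonneg (by positivity) (hx i).1
  have hfloor : ⌊(ℓ : ℝ) ^ n * y i⌋ = ⌊(ℓ : ℝ) ^ n * x i⌋ := congrFun hy i
  rw [natCast_floor_eq_intCast_floor hx0, ← hfloor]
  exact ⟨Int.floor_le _, Int.lt_floor_add_one _⟩

variable {m : Measure (EuclideanSpace ℝ (Fin D))}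

theorem measure_setOf_mul_cubeAt_lt_closedBall_le (hℓ : 0 < ℓ) (n : ℕ) {t : ℝ≥0∞} (ht0 : t ≠ 0)
    (htop : t ≠ ∞) :
    m {x ∈ unitCube D | t * m (cubeAt ℓ D n x) < m (Metric.closedBall x ((ℓ : ℝ) ^ n)⁻¹)} ≤
      t⁻¹ * ((Finset.Icc (-1 : Fin D → ℤ) 1).card * m univ) := by
  set ν := m.map (gridIndex ℓ n)
  have hg : Measurable (gridIndex ℓ n : EuclideanSpace ℝ (Fin D) → Fin D → ℤ) :=
    measurable_gridIndex n
  have hν_apply : ∀ S, ν S = m (gridIndex ℓ n ⁻¹' S) := fun S =>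
    Measure.map_apply hg S.to_countable.measurableSet
  have hmarkov := measure_setOf_mul_le_sum_translates_le ν (Finset.Icc (-1) 1) ht0 htop
  rw [hν_apply, hν_apply univ, preimage_univ] at hmarkov
  refine (measure_mono ?_).trans hmarkov
  rintro x ⟨hx, hlt⟩
  calc t * ν {gridIndex ℓ n x} ≤ t * m (cubeAt ℓ D n x) := by
        rw [hν_apply]
        gcongr
        exact gridIndex_preimage_subset_cubeAt hℓ n hx
    _ ≤ m (Metric.closedBall x ((ℓ : ℝ) ^ n)⁻¹) := hlt.le
    _ ≤ m (⋃ e ∈ Finset.Icc (-1 : Fin D → ℤ) 1, gridIndex ℓ n ⁻¹' {gridIndex ℓ n x + e}) :=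
        measure_mono (closedBall_subset_biUnion_gridIndex hℓ n x)
    _ ≤ ∑ e ∈ Finset.Icc (-1 : Fin D → ℤ) 1, ν {gridIndex ℓ n x + e} := by
        simp only [hν_apply]
        exact measure_biUnion_finset_le _ _

theorem ae_eventually_measureReal_closedBall_le [IsFiniteMeasure m] (hℓ : 0 < ℓ)
    (hm : ∀ᵐ x ∂m, x ∈ unitCube D) :
    ∀ᵐ x ∂m, ∀ᶠ n : ℕ in atTop, m.real (Metric.closedBall x ((ℓ : ℝ) ^ n)⁻¹) ≤
      ((n : ℝ) + 1) ^ 2 * m.real (cubeAt ℓ D n x) := by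
  set t : ℕ → ℝ≥0∞ := fun n => ENNReal.ofReal (((n : ℝ) + 1) ^ 2)
  have ht0 : ∀ n, t n ≠ 0 := fun n => (ENNReal.ofReal_pos.2 (by positivity)).ne'
  have htsum : ∑' n, (t n)⁻¹ ≠ ∞ := by
    have hs : Summable fun n : ℕ => (((n : ℝ) + 1) ^ 2)⁻¹ := by
      simpa using (summable_nat_add_iff 1).2 (Real.summable_nat_pow_inv.2 one_lt_two)
    refine ne_of_eq_of_ne (tsum_congr fun n => ?_) hs.tsum_ofReal_ne_top
    rw [ENNReal.ofReal_inv_of_pos (by positivity)]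
  have hsum : ∑' n : ℕ, m {x ∈ unitCube D |
      t n * m (cubeAt ℓ D n x) < m (Metric.closedBall x ((ℓ : ℝ) ^ n)⁻¹)} ≠ ∞ := by
    refine ne_top_of_le_ne_top ?_ (ENNReal.tsum_le_tsum fun n =>
      measure_setOf_mul_cubeAt_lt_closedBall_le hℓ n (ht0 n) ENNReal.ofReal_ne_top)
    rw [ENNReal.tsum_mul_right]
    exact ENNReal.mul_ne_top htsum
      (ENNReal.mul_ne_top (ENNReal.natCast_ne_top _) (measure_ne_top _ _))
  filter_upwards [hm, ae_eventually_notMem hsum] with x hx hev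
  filter_upwards [hev] with n hn
  have hle := ENNReal.toReal_mono (ENNReal.mul_ne_top ENNReal.ofReal_ne_top (measure_ne_top _ _))
    (not_lt.1 fun hlt => hn ⟨hx, hlt⟩)
  rwa [ENNReal.toReal_mul, ENNReal.toReal_ofReal (by positivity)] at hle

end Balls

/-! ### Masses of cubes along almost every point -/

section AlmostEvery

variable {ℓ D : ℕ} {m : Measure (EuclideanSpace ℝ (Fin D))}

theorem ae_forall_measureReal_cubeAt_pos [IsFiniteMeasure m] (hℓ : 0 < ℓ)
    (hm : ∀ᵐ x ∂m, x ∈ unitCube D) : ∀ᵐ x ∂m, ∀ n, 0 < m.real (cubeAt ℓ D n x) := by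
  refine ae_all_iff.2 fun n => ?_
  have hnull : m (⋃ k ∈ {k | m (adicCube ℓ D n k) = 0}, adicCube ℓ D n k) = 0 :=
    (measure_biUnion_null_iff (to_countable _)).2 fun k hk => hk
  filter_upwards [hm, measure_eq_zero_iff_ae_notMem.1 hnull] with x hx hxnull
  exact ENNReal.toReal_pos (fun hzero => hxnull (mem_biUnion hzero (mem_cubeAt hℓ hx)))
    (measure_ne_top _ _)

theorem S_eq_neg_logb [IsProbabilityMeasure m] (hm : ∀ᵐ x ∂m, x ∈ unitCube D)
    {x : EuclideanSpace ℝ (Fin D)} (hx : x ∈ unitCube D)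
    (hpos : ∀ n, 0 < m.real (cubeAt ℓ D n x)) (n : ℕ) :
    S ℓ m n x = -Real.logb ℓ (m.real (cubeAt ℓ D n x)) := by
  induction n with
  | zero =>
    have hone : m.real (unitCube D) = 1 :=
      (measureReal_congr (eventuallyEq_univ.2 hm)).trans probReal_univ
    simp [S, cubeAt_zero hx, hone]
  | succ n ih =>
    rw [S] at ih ⊢
    rw [Finset.sum_Icc_succ_top (Nat.le_add_left 1 n), ih, X, Nat.add_sub_cancel,
      Real.logb_div (hpos _).ne' (hpos _).ne']
    ring

variable {χ : ℝ → ℝ} {K d : ℝ}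

theorem le_limsup_of_frequently_cubeAt_le [IsProbabilityMeasure m] (hℓ : 2 ≤ ℓ)
    (hm : ∀ᵐ x ∂m, x ∈ unitCube D) (hχ : IsDoublingRate χ K) {a : ℝ}
    {x : EuclideanSpace ℝ (Fin D)} (hx : x ∈ unitCube D)
    (hpos : ∀ n, 0 < m.real (cubeAt ℓ D n x))
    (hlight : ∃ᶠ n in atTop, m.real (cubeAt ℓ D n x) ≤ gaugeSeq χ ℓ d a n) :
    (a : EReal) ≤
      limsup (fun n : ℕ => (((S ℓ m n x - n * d) / rateScale χ n : ℝ) : EReal)) atTop := by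
  have hb : (1 : ℝ) < ℓ := by exact_mod_cast hℓ
  have hθ := tendsto_natCast_atTop_atTop.eventually (hχ.tendsto_rateScale.eventually_gt_atTop 0)
  refine le_limsup_of_frequently_le' ((hlight.and_eventually hθ).mono ?_)
  rintro n ⟨hle, hθn⟩
  have hlog := (Real.logb_le_iff_le_rpow hb (hpos n)).2 hle
  rw [EReal.coe_le_coe_iff, S_eq_neg_logb hm hx hpos, le_div_iff₀ hθn]
  linarith

variable {I : List (Fin (ℓ ^ D)) → Set (EuclideanSpace ℝ (Fin D))} {C M : ℝ}

namespace IsAdicCoding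

theorem ae_one_le_limsup [IsProbabilityMeasure m] (hI : IsAdicCoding ℓ D I) (hℓ : 2 ≤ ℓ)
    (hm : ∀ᵐ x ∂m, x ∈ unitCube D) (h : IsQuasiBernoulliWeight (fun w => m.real (I w)) C)
    (hχ : IsDoublingRate χ K) (hmom : HasMomentRate (fun w => m.real (I w)) ℓ d χ M) :
    ∀ᵐ x ∂m, (1 : EReal) ≤
      limsup (fun n : ℕ => (((S ℓ m n x - n * d) / rateScale χ n : ℝ) : EReal)) atTop := by
  obtain ⟨a, -, ha, hlim⟩ := exists_seq_strictMono_tendsto' (zero_lt_one (α := ℝ))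
  have hlight := ae_all_iff.2 fun k =>
    hI.ae_frequently_measureReal_cubeAt_le hℓ hm h hχ hmom (ha k).1 (ha k).2
  filter_upwards [hm, ae_forall_measureReal_cubeAt_pos (ℓ := ℓ) (by omega) hm, hlight]
    with x hx hpos hxa
  exact le_of_tendsto' ((continuous_coe_real_ereal.tendsto 1).comp hlim) fun k =>
    le_limsup_of_frequently_cubeAt_le hℓ hm hχ hx hpos (hxa k)

variable [IsFiniteMeasure m]

theorem ae_frequently_measureReal_closedBall_le (hI : IsAdicCoding ℓ D I) (hℓ : 2 ≤ ℓ)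
    (hm : ∀ᵐ x ∂m, x ∈ unitCube D) (h : IsQuasiBernoulliWeight (fun w => m.real (I w)) C)
    (hχ : IsDoublingRate χ K) (hmom : HasMomentRate (fun w => m.real (I w)) ℓ d χ M) {a : ℝ}
    (ha0 : 0 < a) (ha1 : a < 1) (N : ℕ) :
    ∀ᵐ x ∂m, ∃ᶠ n : ℕ in atTop,
      m.real (Metric.closedBall x ((ℓ : ℝ) ^ n)⁻¹) ≤ gaugeSeq χ ℓ d a (N + n) := by
  have hb : (1 : ℝ) < ℓ := by exact_mod_cast hℓ
  obtain ⟨a₂, haa₂, ha₂⟩ := exists_between ha1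
  obtain ⟨a₁, haa₁, ha₁₂⟩ := exists_between haa₂
  have hpoly := hχ.eventually_pow_mul_gaugeSeq_le hb ha₁₂ d 2
  have hshift := hχ.eventually_mul_gaugeSeq_le_gaugeSeq_add hb ha0 haa₁ one_pos d N
  filter_upwards [ae_eventually_measureReal_closedBall_le (ℓ := ℓ) (by omega) hm,
    hI.ae_frequently_measureReal_cubeAt_le hℓ hm h hχ hmom (ha0.trans haa₂) ha₂] with x hball hcube
  refine (hcube.and_eventually (hball.and (hpoly.and hshift))).mono ?_
  rintro n ⟨hcube, hball, hpoly, hshift⟩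
  calc m.real (Metric.closedBall x ((ℓ : ℝ) ^ n)⁻¹)
      ≤ ((n : ℝ) + 1) ^ 2 * m.real (cubeAt ℓ D n x) := hball
    _ ≤ ((n : ℝ) + 1) ^ 2 * gaugeSeq χ ℓ d a₂ n := by gcongr
    _ ≤ gaugeSeq χ ℓ d a₁ n := hpoly
    _ ≤ gaugeSeq χ ℓ d a (N + n) := by rwa [one_mul] at hshift

theorem absolutelyContinuous_packingMeasure_of_gaugeSeq_le (hI : IsAdicCoding ℓ D I) (hℓ : 2 ≤ ℓ)
    (hm : ∀ᵐ x ∂m, x ∈ unitCube D) (h : IsQuasiBernoulliWeight (fun w => m.real (I w)) C)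
    (hχ : IsDoublingRate χ K) (hmom : HasMomentRate (fun w => m.real (I w)) ℓ d χ M) {a : ℝ}
    (ha0 : 0 < a) (ha1 : a < 1) {ψ : ℝ → ℝ}
    (hψ : ∀ᶠ n : ℕ in atTop, gaugeSeq χ ℓ d a n ≤ ψ ((ℓ : ℝ) ^ n)⁻¹) :
    m ≪ packingMeasure fun t => ENNReal.ofReal (ψ t) := by
  have hb : (2 : ℝ) ≤ ℓ := by exact_mod_cast hℓ
  set r : ℕ → ℝ := fun n => ((ℓ : ℝ) ^ (2 + n))⁻¹ / 2
  have hr_double : ∀ n, 2 * r n = ((ℓ : ℝ) ^ (2 + n))⁻¹ := fun n => mul_div_cancel₀ _ two_ne_zero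
  have hr_five : ∀ n, 5 * r n ≤ ((ℓ : ℝ) ^ n)⁻¹ := fun n => by
    have hsq : ((ℓ : ℝ) ^ 2)⁻¹ ≤ 1 / 4 := by
      rw [one_div]
      exact inv_anti₀ (by norm_num) (by nlinarith)
    have hmul := mul_le_mul_of_nonneg_right hsq (by positivity : 0 ≤ ((ℓ : ℝ) ^ n)⁻¹)
    have hn : 0 ≤ ((ℓ : ℝ) ^ n)⁻¹ := by positivity
    rw [← mul_inv, ← pow_add, ← hr_double] at hmul
    linarith
  have hr_tendsto : Tendsto r atTop (𝓝[>] 0) := by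
    refine tendsto_nhdsWithin_iff.2 ⟨?_, .of_forall fun n => show 0 < r n by positivity⟩
    have hpow := (tendsto_pow_atTop_atTop_of_one_lt (by linarith : (1 : ℝ) < ℓ)).comp
      (tendsto_add_atTop_nat 2)
    simpa [r, Function.comp_def, add_comm] using (tendsto_inv_atTop_zero.comp hpow).div_const 2
  refine absolutelyContinuous_packingMeasure ?_
  filter_upwards [hI.ae_frequently_measureReal_closedBall_le hℓ hm h hχ hmom ha0 ha1 2] with x hx
  refine hr_tendsto.frequently (hx.and_eventually
    ((tendsto_add_atTop_nat 2).eventually hψ) |>.mono ?_)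
  rintro n ⟨hball, hgauge⟩
  rw [hr_double, ← ofReal_measureReal]
  rw [add_comm n 2] at hgauge
  exact ENNReal.ofReal_le_ofReal <|
    (measureReal_mono (Metric.closedBall_subset_closedBall (hr_five n))).trans (hball.trans hgauge)

end IsAdicCoding

end AlmostEvery

/-! ### The spectrum -/

section Spectrum

variable {ℓ D : ℕ} {m : Measure (EuclideanSpace ℝ (Fin D))}

theorem psi_inv_pow (hℓ : 2 ≤ ℓ) (a : ℝ) (n : ℕ) :
    psi ℓ m a ((ℓ : ℝ) ^ n)⁻¹ = gaugeSeq (chi ℓ m) ℓ (dimension ℓ m) a n := by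
  have hb : (1 : ℝ) < ℓ := by exact_mod_cast hℓ
  have hb0 : (0 : ℝ) < ℓ := by linarith
  have hlog : Real.logb ℓ (1 / ((ℓ : ℝ) ^ n)⁻¹) = n := by
    rw [one_div, inv_inv, ← Real.rpow_natCast, Real.logb_rpow hb0 hb.ne']
  rw [psi, hlog, ← Real.rpow_natCast, ← Real.rpow_neg hb0.le, ← Real.rpow_mul hb0.le,
    ← Real.rpow_add hb0, neg_mul, ← neg_add]
  rfl

theorem IsDoublingRate.eventually_gaugeSeq_le_rpow {χ : ℝ → ℝ} {K a b : ℝ}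
    (hχ : IsDoublingRate χ K) (hb : 1 ≤ b) (ha : 0 ≤ a) (d : ℝ) :
    ∀ᶠ n : ℕ in atTop, gaugeSeq χ b d a n ≤ ((b ^ n)⁻¹) ^ d := by
  have hb0 : 0 ≤ b := zero_le_one.trans hb
  filter_upwards [tendsto_natCast_atTop_atTop.eventually
    (hχ.tendsto_rateScale.eventually_ge_atTop 0)] with n hθ
  rw [← Real.rpow_natCast, ← Real.rpow_neg hb0, ← Real.rpow_mul hb0]
  refine Real.rpow_le_rpow_of_exponent_le hb ?_
  linarith [mul_nonneg ha hθ]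

theorem convexOn_of_tendsto {E : Type*} [AddCommMonoid E] [Module ℝ E] {s : Set E}
    {f : ℕ → E → ℝ} {g : E → ℝ} (hf : ∀ n, ConvexOn ℝ s (f n))
    (hlim : ∀ x ∈ s, Tendsto (fun n => f n x) atTop (𝓝 (g x))) : ConvexOn ℝ s g := by
  refine ⟨(hf 0).1, fun x hx y hy a b ha hb hab => ?_⟩
  exact le_of_tendsto_of_tendsto' (hlim _ ((hf 0).1 hx hy ha hb hab))
    (((hlim x hx).const_smul a).add ((hlim y hy).const_smul b))
    fun n => (hf n).2 hx hy ha hb hab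

namespace IsAdicCoding

variable {I : List (Fin (ℓ ^ D)) → Set (EuclideanSpace ℝ (Fin D))} {C : ℝ}
  (hI : IsAdicCoding ℓ D I)

include hI

theorem isQuasiBernoulliWeight [IsProbabilityMeasure m] (hℓ : 0 < ℓ)
    (hm : ∀ᵐ x ∂m, x ∈ unitCube D) (hC : 0 < C)
    (hqB : ∀ u v, 1 / C * (m.real (I u) * m.real (I v)) ≤ m.real (I (u ++ v)) ∧
      m.real (I (u ++ v)) ≤ C * (m.real (I u) * m.real (I v))) :
    IsQuasiBernoulliWeight (fun w => m.real (I w)) C where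
  nonneg _ := measureReal_nonneg
  sum_eq_one n := by
    simpa only [univ_inter, probReal_univ] using (hI.measureReal_eq_sum hℓ hm n .univ).symm
  mul_le u v := by simpa only [one_div, inv_mul_le_iff₀ hC] using (hqB u v).1
  append_le u v := (hqB u v).2

theorem tauN_eq (n : ℕ) (q : ℝ) :
    tauN ℓ m n q = Real.log (partitionSum (fun w => m.real (I w)) n q) / n / Real.log ℓ := by
  have hbij : BijOn I ({w ∈ words (Fin (ℓ ^ D)) n | 0 < m.real (I w)} : Finset _)
      {Q ∈ adicCubes ℓ D n | 0 < m.real Q} := by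
    rw [Finset.coe_filter]
    simp only [mem_words]
    exact (hI.bijOn n).inter_mapsTo (s₂ := {w | 0 < m.real (I w)}) (t₂ := {Q | 0 < m.real Q})
      (fun _ hw => hw) fun _ hw => hw.2
  rw [tauN, partitionSum, ← finsum_mem_coe_finset,
    finsum_mem_eq_of_bijOn I hbij (g := fun Q => m.real Q ^ q) (fun _ _ => rfl),
    one_div_mul_eq_div, div_div]

variable (h : IsQuasiBernoulliWeight (fun w => m.real (I w)) C)

include h

theorem tendsto_tauN (q : ℝ) : Tendsto (fun n => tauN ℓ m n q) atTop (𝓝 (tau ℓ m q)) := by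
  obtain ⟨L, hL⟩ := h.exists_log_partitionSum_approx q
  have hlim := (tendsto_div_of_linear_approx hL).div_const (Real.log ℓ)
  simp only [← hI.tauN_eq] at hlim
  rwa [tau, hlim.limsup_eq]

theorem abs_log_partitionSum_sub_le (hℓ : 2 ≤ ℓ) (n : ℕ) (q : ℝ) :
    |Real.log (partitionSum (fun w => m.real (I w)) n q) - n * (tau ℓ m q * Real.log ℓ)| ≤
      |q| * Real.log C := by
  obtain ⟨L, hL⟩ := h.exists_log_partitionSum_approx q
  have hlog : Real.log ℓ ≠ 0 := (Real.log_pos (by exact_mod_cast hℓ)).ne'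
  have hlim := (tendsto_div_of_linear_approx hL).div_const (Real.log ℓ)
  simp only [← hI.tauN_eq] at hlim
  rw [tendsto_nhds_unique (hI.tendsto_tauN h q) hlim, div_mul_cancel₀ _ hlog]
  exact hL n

theorem convexOn_tau : ConvexOn ℝ univ (tau ℓ m) := by
  refine convexOn_of_tendsto (fun n => ?_) fun q _ => hI.tendsto_tauN h q
  refine ((h.convexOn_log_partitionSum n).smul
    (c := 1 / (n * Real.log ℓ)) (by positivity)).congr fun q _ => ?_
  rw [hI.tauN_eq, div_div]
  exact one_div_mul_eq_div _ _

theorem tau_one : tau ℓ m 1 = 0 := by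
  refine tendsto_nhds_unique (hI.tendsto_tauN h 1) ?_
  simp only [hI.tauN_eq, h.partitionSum_one, Real.log_one, zero_div]
  exact tendsto_const_nhds

theorem convexOn_chi : ConvexOn ℝ univ (chi ℓ m) := by
  refine ⟨convex_univ, fun x _ y _ a b ha hb hab => ?_⟩
  have htau := (hI.convexOn_tau h).2 (mem_univ (1 - x)) (mem_univ (1 - y)) ha hb hab
  have hpoint : a * (1 - x) + b * (1 - y) = 1 - (a * x + b * y) := by linear_combination hab
  simp only [chi, smul_eq_mul] at htau ⊢
  rw [hpoint] at htau
  linarith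

theorem isDoublingRate_chi {K : ℝ}
    (hχ : ∀ q ∈ Ioc (0 : ℝ) 1, 0 < chi ℓ m q ∧ chi ℓ m q ≤ K * chi ℓ m (q / 2)) :
    IsDoublingRate (chi ℓ m) K where
  convex := hI.convexOn_chi h
  zero := by simp [chi, hI.tau_one h]
  pos q hq := (hχ q hq).1
  doubling q hq := (hχ q hq).2

theorem abs_log_moment_sub_le (hℓ : 2 ≤ ℓ) (n : ℕ) {q : ℝ} (hq : q ∈ Icc (0 : ℝ) 1) :
    |Real.log (moment (fun w => m.real (I w)) ℓ (dimension ℓ m) n q) -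
      Real.log ((ℓ : ℝ) ^ (n * chi ℓ m q))| ≤ Real.log C := by
  have hb : (0 : ℝ) < ℓ := by exact_mod_cast (by omega : 0 < ℓ)
  have hq1 : |1 - q| ≤ 1 := abs_le.2 ⟨by linarith [hq.2], by linarith [hq.1]⟩
  rw [h.moment_eq hb, Real.log_mul (Real.rpow_pos_of_pos hb _).ne' (h.partitionSum_pos n _).ne',
    Real.log_rpow hb, Real.log_rpow hb]
  refine Eq.trans_le ?_ ((hI.abs_log_partitionSum_sub_le h hℓ n (1 - q)).trans
    (mul_le_of_le_one_left (Real.log_nonneg h.one_le) hq1))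
  rw [chi]
  ring_nf

theorem hasMomentRate (hℓ : 2 ≤ ℓ) :
    HasMomentRate (fun w => m.real (I w)) ℓ (dimension ℓ m) (chi ℓ m) C := by
  have hb : (0 : ℝ) < ℓ := by exact_mod_cast (by omega : 0 < ℓ)
  have hpow : ∀ t : ℝ, 0 < (ℓ : ℝ) ^ t := Real.rpow_pos_of_pos hb
  have hmom : ∀ n q, 0 < moment (fun w => m.real (I w)) ℓ (dimension ℓ m) n q := fun n q => by
    rw [h.moment_eq hb]
    exact mul_pos (hpow _) (h.partitionSum_pos n _)
  refine ⟨h.pos, fun n q hq => ?_, fun n q hq => ?_⟩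
  · refine le_mul_of_abs_log_sub_log_le (hpow _) (hmom n q) h.pos ?_
    rw [abs_sub_comm]
    exact hI.abs_log_moment_sub_le h hℓ n hq
  · exact le_mul_of_abs_log_sub_log_le (hmom n q) (hpow _) h.pos
      (hI.abs_log_moment_sub_le h hℓ n hq)

end IsAdicCoding

end Spectrum

end QuasiBernoulli

end

open QuasiBernoulli in
theorem mainTheorem10 (ℓ D : ℕ) (hℓ : 2 ≤ ℓ) (hD : 1 ≤ D)
    (m : MeasureTheory.Measure (EuclideanSpace ℝ (Fin D)))
    [MeasureTheory.IsProbabilityMeasure m] (hm : m (unitCube D) = 1)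
    (I : List (Fin (ℓ ^ D)) → Set (EuclideanSpace ℝ (Fin D))) (hI : IsAdicCoding ℓ D I)
    (hqB : IsQuasiBernoulli I m)
    (hχ : ∃ C : ℝ, 0 < C ∧ ∀ q ∈ Set.Ioc (0 : ℝ) 1,
      0 < chi ℓ m q ∧ chi ℓ m q ≤ C * chi ℓ m (q / 2)) :
    Set.BijOn (chi ℓ m) (Set.Icc 0 1) (Set.Icc 0 (chi ℓ m 1)) ∧
    (∀ᵐ x ∂m, (1 : EReal) ≤ Filter.limsup
      (fun n : ℕ => (((S ℓ m n x - n * dimension ℓ m) / theta ℓ m n : ℝ) : EReal))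
      Filter.atTop) ∧
    (∀ a : ℝ, 0 < a → a < 1 →
      m.AbsolutelyContinuous (packingMeasure fun t => ENNReal.ofReal (psi ℓ m a t))) ∧
    m.AbsolutelyContinuous (packingMeasure fun t => ENNReal.ofReal (t ^ dimension ℓ m)) := by
  obtain ⟨C, hC, hqB⟩ := hqB
  obtain ⟨K, -, hχ⟩ := hχ
  have hae : ∀ᵐ x ∂m, x ∈ unitCube D :=
    (MeasureTheory.mem_ae_iff_prob_eq_one measurableSet_unitCube).2 hm
  have h := hI.isQuasiBernoulliWeight (by omega) hae (by linarith) hqB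
  have hrate := hI.isDoublingRate_chi h hχ
  have hmom := hI.hasMomentRate h hℓ
  refine ⟨hrate.bijOn, hI.ae_one_le_limsup hℓ hae h hrate hmom, fun a ha0 ha1 => ?_, ?_⟩
  · exact hI.absolutelyContinuous_packingMeasure_of_gaugeSeq_le hℓ hae h hrate hmom ha0 ha1
      (.of_forall fun n => (psi_inv_pow hℓ a n).ge)
  · have hb : (1 : ℝ) ≤ ℓ := by exact_mod_cast (by omega : 1 ≤ ℓ)
    exact hI.absolutelyContinuous_packingMeasure_of_gaugeSeq_le hℓ hae h hrate hmom
      one_half_pos one_half_lt_one (hrate.eventually_gaugeSeq_le_rpow hb one_half_pos.le _)
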